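/- Setting. Let $d\ge 1$, $\|\cdot\|$ the maximum norm on $\mathbb Z^d$, and $B_L(x)=\{y\in\mathbb Z^d:\|y-x\|\le L\}$. Let $\gamma>0$, $\rho>1$, $\varepsilon>0$, and let $\phi:\mathbb Z^d\to\mathbb C$ satisfy $\phi(x-y)=\overline{\phi(y-x)}$ and $|\phi(x)|\le e^{-\gamma\log^\rho(\|x\|+1)}$. Let $\{V_\omega(x)\}_{x\in\mathbb Z^d}$ be i.i.d. real random variables on a probability space $(\Omega,\mathcal F,\mathbb P)$, and let $H_\omega(x,y)=\varepsilon\phi(x-y)+V_\omega(x)\delta_{x,y}$. For a finite $B\subset\mathbb Z^d$ let $H_B$ be the restriction of $H_\omega$ to $B$, and for $E\notin\sigma(H_B)$ let $\mathcal G_B^E=(H_B-E)^{-1}$. Let $1<\rho'<\rho$. The cube $B_L(x)$ is $E$-NR if $\mathrm{dist}(E,\sigma(H_{B_L(x)}))\ge e^{-\log^{\rho'}L}$, and $E$-R otherwise. It is $(\kappa,E)$-good if it is $E$-NR and $|\mathcal G^E_{B_L(x)}(x,y)|\le e^{-\kappa\log^\rho(\|x-y\|+1)}$ for all $y\in B_L(x)$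 with $\|y-x\|>L^{4/5}$, and $(\kappa,E)$-bad otherwise. For $l\in\mathbb N$ put $$m(l)=\gamma\frac{11}{\log^{\rho-1}l}+\gamma\frac{11}{l^{\frac45\alpha-1}}+\frac{31+2^\rho}{\log^{\rho-\rho'}l}.$$ Theorem. Let $d\ge1$, $1<\rho'<\rho$, $p>5d$, $\alpha\in\left(\frac45,\frac{2p}{p+2d}\right)$, $\kappa>0$ and $\varepsilon_1>0$. There is $\underline l_0=\underline l_0(\rho,\rho',p,d,\alpha,\kappa,\varepsilon_1)>0$, and for every $\gamma>0$ there is $\underline l_1=\underline l_1(\rho,\rho',p,d,\alpha,\kappa,\varepsilon_1,\gamma)>0$, such that the following holds for all $\kappa_0$ with $\kappa\le\kappa_0\le\gamma/5$, all $\phi$, $V_\omega$ as above, all $0<\varepsilon\le\varepsilon_1$, all $I\subset\mathbb R$, and all $l\in\mathbb N$ with $l\ge\underline l_0$, where $L=[l^\alpha]$. Suppose that $m(l)\le\kappa$ and that (P1) $\mathbb P\{\exists E\in I:\ B_l(x)\text{ and }B_l(y)\text{ are both }(\kappa,E)\text{-bad}\}\le l^{-2p}$ for all $\|x-y\|>2l$;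 (P2) $\mathbb P\left\{\bigcup_{E\in I}(\mathbf D_x(E)\cap\mathbf D_y(E))\right\}\le\frac14L^{-2p}$ for all $\|x-y\|>2L$, where $\mathbf D_x(E)$ is the event that $B_L(x)$, or one of $B_{2l}(z),B_{8l}(z),B_{26l}(z)$ for some $z\in B_L(x)$, is $E$-R. Then, with $$\kappa'=\kappa-\left(\gamma\frac{10}{l^{\frac45\alpha-1}}+\gamma\frac{10}{\log^{\rho-1}l}+\frac{30+2^\rho}{\log^{\rho-\rho'}l}\right),$$ we have $$\mathbb P\{\exists E\in I:\ B_L(x)\text{ and }B_L(y)\text{ are both }(\kappa',E)\text{-bad}\}\le L^{-2p}\quad\text{for all }\|x-y\|>2L,$$ and $0<\kappa'<\kappa\le\kappa_0$. If moreover $l\ge\underline l_1$, then $m(L)\le\kappa'$. -/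

import Mathlib

namespace MSA

/-- The cube `B_L(x) = {y ∈ ℤ^d : ‖y - x‖ ≤ L}`; see `mem_cube`. The norm on `Fin d → ℤ` is the
maximum norm. -/
noncomputable def cube {d : ℕ} (L : ℕ) (x : Fin d → ℤ) : Finset (Fin d → ℤ) :=
  Finset.Icc (fun i => x i - (L : ℤ)) (fun i => x i + (L : ℤ))

theorem mem_cube {d : ℕ} (L : ℕ) (x y : Fin d → ℤ) :
    y ∈ cube L x ↔ ‖y - x‖ ≤ (L : ℝ) := by
  rw [pi_norm_le_iff_of_nonneg (Nat.cast_nonneg L)]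
  simp only [cube, Finset.mem_Icc, Pi.le_def, Pi.sub_apply, Int.norm_eq_abs]
  rw [← forall_and]
  refine forall_congr' fun i => ?_
  have h : (|((y i - x i : ℤ) : ℝ)| ≤ (L : ℝ)) ↔ |y i - x i| ≤ (L : ℤ) := by
    rw [← Int.cast_abs]
    exact_mod_cast Iff.rfl
  rw [h, abs_le]
  constructor <;> rintro ⟨h1, h2⟩ <;> constructor <;> linarith

theorem self_mem_cube {d : ℕ} (L : ℕ) (x : Fin d → ℤ) : x ∈ cube L x := by
  simp [mem_cube]

/-- `Γ_φ(x, y) = φ(x - y)` is a Hermitian hopping term with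
`|φ(x)| ≤ exp (-γ log^ρ (‖x‖ + 1))`. -/
structure IsHopping {d : ℕ} (γ ρ : ℝ) (φ : (Fin d → ℤ) → ℂ) : Prop where
  hermitian : ∀ x y : Fin d → ℤ, φ (x - y) = star (φ (y - x))
  decay : ∀ x : Fin d → ℤ, ‖φ x‖ ≤ Real.exp (-γ * Real.log (‖x‖ + 1) ^ ρ)

/-- The matrix element `H(x, y) = ε φ(x - y) + v(x) δ_{x,y}` of the operator with potential `v`. -/
noncomputable def kernel {d : ℕ} (ε : ℝ) (φ : (Fin d → ℤ) → ℂ) (v : (Fin d → ℤ) → ℝ)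
    (x y : Fin d → ℤ) : ℂ :=
  (ε : ℂ) * φ (x - y) + if x = y then (v x : ℂ) else 0

/-- The restriction `H_B = R_B H R_B` to a finite set `B`, as a matrix acting on `ℓ²(B)`. -/
noncomputable def restrict {d : ℕ} (ε : ℝ) (φ : (Fin d → ℤ) → ℂ) (v : (Fin d → ℤ) → ℝ)
    (B : Finset (Fin d → ℤ)) : Matrix B B ℂ :=
  Matrix.of fun x y => kernel ε φ v x y

/-- The Green's function `(H_B - E)⁻¹`; meaningful for `E ∉ σ(H_B)`, and only used there. -/
noncomputable def green {d : ℕ} (ε : ℝ) (φ : (Fin d → ℤ) → ℂ) (v : (Fin d → ℤ) → ℝ)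
    (B : Finset (Fin d → ℤ)) (E : ℝ) : Matrix B B ℂ :=
  (restrict ε φ v B - (E : ℂ) • (1 : Matrix B B ℂ))⁻¹

/-- `B_L(x)` is non-resonant at `E`: `dist (E, σ(H_{B_L(x)})) ≥ exp (-log^ρ' L)`. -/
def IsNR {d : ℕ} (ρ' ε : ℝ) (φ : (Fin d → ℤ) → ℂ) (v : (Fin d → ℤ) → ℝ)
    (E : ℝ) (L : ℕ) (x : Fin d → ℤ) : Prop :=
  Real.exp (-(Real.log L ^ ρ')) ≤
    Metric.infDist (E : ℂ) (spectrum ℂ (restrict ε φ v (cube L x)))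

/-- `B_L(x)` is `(κ, E)`-good: it is non-resonant at `E` and
`|G(x, y)| ≤ exp (-κ log^ρ (‖x - y‖ + 1))` for all `y ∈ B_L(x)` with `‖y - x‖ > L^{4/5}`. -/
def IsGood {d : ℕ} (ρ ρ' ε : ℝ) (φ : (Fin d → ℤ) → ℂ) (v : (Fin d → ℤ) → ℝ)
    (κ E : ℝ) (L : ℕ) (x : Fin d → ℤ) : Prop :=
  IsNR ρ' ε φ v E L x ∧
    ∀ y : cube L x, (L : ℝ) ^ (4 / 5 : ℝ) < ‖(y : Fin d → ℤ) - x‖ →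
      ‖green ε φ v (cube L x) E ⟨x, self_mem_cube L x⟩ y‖ ≤
        Real.exp (-κ * Real.log (‖x - (y : Fin d → ℤ)‖ + 1) ^ ρ)

/-- The event `D_x(E)`: `B_L(x)`, or one of `B_{2l}(z)`, `B_{8l}(z)`, `B_{26l}(z)` with
`z ∈ B_L(x)`, is resonant at `E`. -/
def HasResonance {d : ℕ} (ρ' ε : ℝ) (φ : (Fin d → ℤ) → ℂ) (v : (Fin d → ℤ) → ℝ)
    (l L : ℕ) (E : ℝ) (x : Fin d → ℤ) : Prop :=
  ¬ IsNR ρ' ε φ v E L x ∨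
    ∃ z ∈ cube L x, ¬ IsNR ρ' ε φ v E (2 * l) z ∨ ¬ IsNR ρ' ε φ v E (8 * l) z ∨
      ¬ IsNR ρ' ε φ v E (26 * l) z

/-- The lower bound required of the decay rate at scale `l`. -/
noncomputable def minRate (γ ρ ρ' α : ℝ) (l : ℕ) : ℝ :=
  γ * (11 / Real.log l ^ (ρ - 1)) + γ * (11 / (l : ℝ) ^ (4 / 5 * α - 1)) +
    (31 + 2 ^ ρ) / Real.log l ^ (ρ - ρ')

/-- The decay rate `κ'` at the next scale. -/
noncomputable def nextRate (γ ρ ρ' α κ : ℝ) (l : ℕ) : ℝ :=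
  κ - (γ * (10 / (l : ℝ) ^ (4 / 5 * α - 1)) + γ * (10 / Real.log l ^ (ρ - 1)) +
    (30 + 2 ^ ρ) / Real.log l ^ (ρ - ρ'))

end MSA

/-!
Whether cubes are bad at a common energy depends only on the potential inside them, so if `B_L(x)`
contains four bad cubes of radius `l` at mutual distance more than `2 l`, they form two independent
bad pairs, and a union bound over their centres gives an event of probability at most
`(2 L + 1) ^ (4 d) l ^ (-4 p) ≤ 3 / 8 * L ^ (-2 p)`. Outside this event all bad cubes have their
centres in at most three clusters, and enlarging the radius through `2 l, 8 l, 26 l` until the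
clusters separate makes them disjoint cubes, non-resonant outside the event of (P2).

The Green's function of `B_L(x)` is then bounded by a maximum principle instead of an iteration. The
geometric resolvent identity bounds `|G(u, y)|` by a weighted sum of the `|G(s, y)|`, with `s`
outside the good `l`-cube about `u` or outside the cluster of `u`, as long as the block avoids `y`.
A weight that decays along the free distance from `x`, the distance with the radii that meet a
cluster left out, makes this a strict contraction, so that its maximum is attained where the
a priori bound of non-resonance applies. As there are only three clusters, the free distance
differs from the true one by `O(l)`, which is negligible against `L ^ (4 / 5)`.
-/

namespace MSA

section Matrix

variable {𝕜 n : Type*} [RCLike 𝕜] [Fintype n] [DecidableEq n]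

/-- `A` is bounded below by `δ` in the Euclidean norm: `δ ‖ψ‖ ≤ ‖A ψ‖` for all `ψ`. -/
def IsBoundedBelow (δ : ℝ) (A : Matrix n n 𝕜) : Prop :=
  ∀ ψ : EuclideanSpace 𝕜 n, δ * ‖ψ‖ ≤ ‖A.toEuclideanLin ψ‖

theorem toEuclideanLin_sub_smul_apply (A : Matrix n n 𝕜) (z : 𝕜) (ψ : EuclideanSpace 𝕜 n) :
    (A - z • 1).toEuclideanLin ψ = A.toEuclideanLin ψ - z • ψ := by
  simp

theorem toEuclideanLin_eigenvectorBasis {A : Matrix n n 𝕜} (hA : A.IsHermitian) (i : n) :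
    A.toEuclideanLin (hA.eigenvectorBasis i) =
      (hA.eigenvalues i : 𝕜) • hA.eigenvectorBasis i := by
  rw [Matrix.toLpLin_apply, hA.mulVec_eigenvectorBasis, WithLp.toLp_smul, WithLp.toLp_ofLp,
    RCLike.real_smul_eq_coe_smul (K := 𝕜)]

theorem inner_eigenvectorBasis_toEuclideanLin_sub_smul {A : Matrix n n 𝕜} (hA : A.IsHermitian)
    (z : 𝕜) (i : n) (ψ : EuclideanSpace 𝕜 n) :
    inner 𝕜 (hA.eigenvectorBasis i) ((A - z • 1).toEuclideanLin ψ) =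
      ((hA.eigenvalues i : 𝕜) - z) * inner 𝕜 (hA.eigenvectorBasis i) ψ := by
  rw [toEuclideanLin_sub_smul_apply, inner_sub_right, inner_smul_right,
    ← Matrix.isSymmetric_toEuclideanLin_iff.2 hA, toEuclideanLin_eigenvectorBasis,
    inner_smul_left, RCLike.conj_ofReal, sub_mul]

theorem le_infDist_spectrum_iff_isBoundedBelow [Nonempty n] {A : Matrix n n 𝕜}
    (hA : A.IsHermitian) (z : 𝕜) {δ : ℝ} (hδ : 0 ≤ δ) :
    δ ≤ Metric.infDist z (spectrum 𝕜 A) ↔ IsBoundedBelow δ (A - z • 1) := by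
  have hdist : δ ≤ Metric.infDist z (spectrum 𝕜 A) ↔
      ∀ i, δ ≤ ‖(hA.eigenvalues i : 𝕜) - z‖ := by
    rw [hA.spectrum_eq_image_range,
      Metric.le_infDist ((Set.range_nonempty _).image _)]
    simp [dist_eq_norm, norm_sub_rev z]
  rw [hdist]
  constructor
  · intro h ψ
    refine le_of_sq_le_sq ?_ (norm_nonneg _)
    rw [mul_pow, ← hA.eigenvectorBasis.sum_sq_norm_inner_right,
      ← hA.eigenvectorBasis.sum_sq_norm_inner_right, Finset.mul_sum]
    refine Finset.sum_le_sum fun i _ => ?_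
    rw [inner_eigenvectorBasis_toEuclideanLin_sub_smul, norm_mul, mul_pow]
    gcongr
    exact h i
  · intro h i
    calc δ = δ * ‖hA.eigenvectorBasis i‖ := by simp
      _ ≤ ‖(A - z • 1).toEuclideanLin (hA.eigenvectorBasis i)‖ := h _
      _ = ‖((hA.eigenvalues i : 𝕜) - z) • hA.eigenvectorBasis i‖ := by
        rw [toEuclideanLin_sub_smul_apply, toEuclideanLin_eigenvectorBasis, sub_smul]
      _ = ‖(hA.eigenvalues i : 𝕜) - z‖ := by simp [norm_smul]

theorem IsBoundedBelow.isUnit_det {A : Matrix n n 𝕜} {δ : ℝ} (hA : IsBoundedBelow δ A)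
    (hδ : 0 < δ) : IsUnit A.det := by
  rw [isUnit_iff_ne_zero]
  intro h0
  obtain ⟨ψ, hψ, hAψ⟩ := Matrix.exists_mulVec_eq_zero_iff.2 h0
  have hle := hA (WithLp.toLp 2 ψ)
  rw [Matrix.toLpLin_apply, hAψ, WithLp.toLp_zero, norm_zero] at hle
  have hpos : 0 < ‖WithLp.toLp 2 ψ‖ := norm_pos_iff.2 (by simpa using hψ)
  exact (mul_pos hδ hpos).not_ge hle

theorem IsBoundedBelow.norm_inv_apply_le {A : Matrix n n 𝕜} {δ : ℝ} (hA : IsBoundedBelow δ A)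
    (hδ : 0 < δ) (i j : n) : ‖A⁻¹ i j‖ ≤ δ⁻¹ := by
  set ψ : EuclideanSpace 𝕜 n := A⁻¹.toEuclideanLin (EuclideanSpace.single j 1)
  have hψ : A.toEuclideanLin ψ = EuclideanSpace.single j 1 := by
    rw [← LinearMap.comp_apply, ← Matrix.toLpLin_mul_same,
      Matrix.mul_nonsing_inv _ (hA.isUnit_det hδ)]
    simp
  calc ‖A⁻¹ i j‖ = ‖ψ i‖ := by simp [ψ]
    _ ≤ ‖ψ‖ := PiLp.norm_apply_le ψ i
    _ ≤ δ⁻¹ := by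
      rw [inv_eq_one_div, le_div_iff₀' hδ]
      simpa [hψ] using hA ψ

theorem isClosed_setOf_isBoundedBelow {X : Type*} [TopologicalSpace X] {A : X → Matrix n n 𝕜}
    (hA : Continuous A) (δ : ℝ) : IsClosed {x | IsBoundedBelow δ (A x)} := by
  simp only [IsBoundedBelow, Set.ofPred_forall]
  refine isClosed_iInter fun ψ => isClosed_le continuous_const (Continuous.norm ?_)
  exact (PiLp.continuous_toLp 2 _).comp (hA.matrix_mulVec continuous_const)

end Matrix

section Profile

theorem le_add_of_antitoneOn_div {f : ℝ → ℝ} {a s t u : ℝ} (ha : 0 < a)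
    (hf : AntitoneOn (fun x => f x / x) (Set.Ici a)) (hs : a ≤ s) (ht : a ≤ t) (hsu : s ≤ u)
    (htu : t ≤ u) (hu : u ≤ s + t) (hfu : 0 ≤ f u) : f u ≤ f s + f t := by
  have hs0 : 0 < s := ha.trans_le hs
  have ht0 : 0 < t := ha.trans_le ht
  have hu0 : 0 < u := hs0.trans_le hsu
  have hslope_s : f u / u * s ≤ f s := (le_div_iff₀ hs0).1 (hf hs (hs.trans hsu) hsu)
  have hslope_t : f u / u * t ≤ f t := (le_div_iff₀ ht0).1 (hf ht (ht.trans htu) htu)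
  calc f u = f u / u * u := (div_mul_cancel₀ _ hu0.ne').symm
    _ ≤ f u / u * (s + t) := by gcongr
    _ ≤ f s + f t := by rw [mul_add]; exact add_le_add hslope_s hslope_t

variable {ρ : ℝ}

theorem log_rpow_div_self_antitoneOn (hρ : 0 < ρ) :
    AntitoneOn (fun s : ℝ => Real.log s ^ ρ / s) (Set.Ici (Real.exp ρ)) := by
  intro s hs t ht hst
  have hone {u : ℝ} (hu : Real.exp ρ ≤ u) : 1 ≤ u := (Real.one_le_exp hρ.le).trans hu
  have hpow {u : ℝ} (hu : Real.exp ρ ≤ u) :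
      (Real.log u / u ^ ρ⁻¹) ^ ρ = Real.log u ^ ρ / u := by
    have hu0 : 0 ≤ u := zero_le_one.trans (hone hu)
    rw [Real.div_rpow (Real.log_nonneg (hone hu)) (Real.rpow_nonneg hu0 _),
      Real.rpow_inv_rpow hu0 hρ.ne']
  have hroot : Real.log t / t ^ ρ⁻¹ ≤ Real.log s / s ^ ρ⁻¹ :=
    Real.log_div_self_rpow_antitoneOn (inv_pos.2 hρ) (by simpa using hs) (by simpa using ht) hst
  have hnonneg : 0 ≤ Real.log t / t ^ ρ⁻¹ :=
    div_nonneg (Real.log_nonneg (hone ht))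
      (Real.rpow_nonneg (zero_le_one.trans (hone ht)) _)
  simpa only [hpow hs, hpow ht] using Real.rpow_le_rpow hnonneg hroot hρ.le

theorem log_rpow_mono {s t : ℝ} (hρ : 0 ≤ ρ) (hs : 1 ≤ s) (hst : s ≤ t) :
    Real.log s ^ ρ ≤ Real.log t ^ ρ :=
  Real.rpow_le_rpow (Real.log_nonneg hs) (Real.log_le_log (by linarith) hst) hρ

theorem log_rpow_nonneg {s : ℝ} (ρ : ℝ) (hs : 1 ≤ s) : 0 ≤ Real.log s ^ ρ :=
  Real.rpow_nonneg (Real.log_nonneg hs) _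

theorem log_rpow_subadditive {s t u : ℝ} (hρ : 0 < ρ) (hs : Real.exp ρ ≤ s)
    (ht : Real.exp ρ ≤ t) (hsu : s ≤ u) (htu : t ≤ u) (hu : u ≤ s + t) :
    Real.log u ^ ρ ≤ Real.log s ^ ρ + Real.log t ^ ρ :=
  le_add_of_antitoneOn_div (f := fun x => Real.log x ^ ρ) (Real.exp_pos ρ)
    (log_rpow_div_self_antitoneOn hρ) hs ht hsu htu hu
    (log_rpow_nonneg ρ ((Real.one_le_exp hρ.le).trans (hs.trans hsu)))

/-- The decay profile `log^ρ (t + e^ρ)`. It is within `2 ρ^ρ` of `log^ρ (t + 1)` and, unlike it,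
subadditive on `[0, ∞)`. -/
noncomputable def profile (ρ t : ℝ) : ℝ := Real.log (t + Real.exp ρ) ^ ρ

theorem profile_zero (ρ : ℝ) : profile ρ 0 = ρ ^ ρ := by simp [profile]

theorem profile_nonneg {a : ℝ} (hρ : 0 ≤ ρ) (ha : 0 ≤ a) : 0 ≤ profile ρ a :=
  log_rpow_nonneg ρ (by linarith [Real.one_le_exp hρ])

theorem profile_mono {a b : ℝ} (hρ : 0 ≤ ρ) (ha : 0 ≤ a) (hab : a ≤ b) :
    profile ρ a ≤ profile ρ b :=
  log_rpow_mono hρ (by linarith [Real.one_le_exp hρ]) (by linarith)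

theorem profile_add_le {a b : ℝ} (hρ : 0 < ρ) (ha : 0 ≤ a) (hb : 0 ≤ b) :
    profile ρ (a + b) ≤ profile ρ a + profile ρ b := by
  have := Real.exp_pos ρ
  apply log_rpow_subadditive hρ <;> linarith

theorem log_rpow_le_profile {a : ℝ} (hρ : 0 ≤ ρ) (ha : 0 ≤ a) :
    Real.log (a + 1) ^ ρ ≤ profile ρ a :=
  log_rpow_mono hρ (by linarith) (by linarith [Real.one_le_exp hρ])

theorem profile_le_log_rpow_add {a : ℝ} (hρ : 0 < ρ) (ha : 0 ≤ a) :
    profile ρ a ≤ Real.log (a + 1) ^ ρ + 2 * ρ ^ ρ := by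
  have hexp : Real.log (Real.exp ρ) ^ ρ = ρ ^ ρ := by rw [Real.log_exp]
  have hρρ : 0 ≤ ρ ^ ρ := Real.rpow_nonneg hρ.le _
  have hone := Real.one_le_exp hρ.le
  rcases le_or_gt (Real.exp ρ) (a + 1) with h | h
  · have : profile ρ a ≤ Real.log (a + 1) ^ ρ + Real.log (Real.exp ρ) ^ ρ := by
      apply log_rpow_subadditive hρ <;> linarith
    linarith
  · have : profile ρ a ≤ Real.log (Real.exp ρ) ^ ρ + Real.log (Real.exp ρ) ^ ρ := by
      apply log_rpow_subadditive hρ <;> linarith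
    linarith [log_rpow_nonneg ρ (show 1 ≤ a + 1 by linarith)]

end Profile

section Lattice

variable {ι : Type*} [Fintype ι] {d : ℕ}

/-- The distance of the maximum norm on `ℤ^ι`, as a natural number. -/
def latticeDist (x y : ι → ℤ) : ℕ := Finset.univ.sup fun i => (x i - y i).natAbs

theorem latticeDist_le_iff {x y : ι → ℤ} {n : ℕ} :
    latticeDist x y ≤ n ↔ ∀ i, (x i - y i).natAbs ≤ n := by
  simp [latticeDist]

theorem dist_eq_latticeDist (x y : ι → ℤ) : dist x y = latticeDist x y := by
  have hcoord (i : ι) : dist (x i) (y i) = (x i - y i).natAbs := by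
    rw [Int.dist_eq', Nat.cast_natAbs]
  apply le_antisymm
  · refine (dist_pi_le_iff (Nat.cast_nonneg _)).2 fun i => ?_
    rw [hcoord]
    exact_mod_cast latticeDist_le_iff.1 le_rfl i
  · rw [← Nat.le_floor_iff dist_nonneg, latticeDist_le_iff]
    intro i
    rw [Nat.le_floor_iff dist_nonneg, ← hcoord]
    exact dist_le_pi_dist x y i

theorem latticeDist_self (x : ι → ℤ) : latticeDist x x = 0 := by
  simp [latticeDist]

theorem latticeDist_comm (x y : ι → ℤ) : latticeDist x y = latticeDist y x := by
  exact_mod_cast dist_eq_latticeDist x y ▸ dist_eq_latticeDist y x ▸ dist_comm x y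

theorem latticeDist_triangle (x y z : ι → ℤ) :
    latticeDist x z ≤ latticeDist x y + latticeDist y z := by
  have := dist_triangle x y z
  rw [dist_eq_latticeDist, dist_eq_latticeDist, dist_eq_latticeDist] at this
  exact_mod_cast this

theorem norm_sub_eq_latticeDist (x y : ι → ℤ) : ‖x - y‖ = latticeDist x y := by
  rw [← dist_eq_norm, dist_eq_latticeDist]

theorem mem_cube_iff {L : ℕ} {x y : Fin d → ℤ} : y ∈ cube L x ↔ latticeDist y x ≤ L := by
  rw [mem_cube, norm_sub_eq_latticeDist, Nat.cast_le]

theorem card_cube (L : ℕ) (x : Fin d → ℤ) : (cube L x).card = (2 * L + 1) ^ d := by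
  have hside (i : Fin d) : (Finset.Icc (x i - (L : ℤ)) (x i + L)).card = 2 * L + 1 := by
    rw [Int.card_Icc]
    omega
  simp [cube, Pi.card_Icc, hside]

theorem disjoint_cube {l : ℕ} {x y : Fin d → ℤ} (h : 2 * l < latticeDist x y) :
    Disjoint (cube l x) (cube l y) := by
  rw [Finset.disjoint_left]
  intro z hzx hzy
  rw [mem_cube_iff] at hzx hzy
  have := latticeDist_triangle x z y
  rw [latticeDist_comm x z] at this
  omega

end Lattice

section Resolvent

variable {X R : Type*} [DecidableEq X]

/-- The inverse of the restriction of the infinite matrix `K` to the finite block `B`, extended by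
zero to all of `X × X`. Like `⁻¹` it has a junk value if the restriction is singular. -/
noncomputable def blockInv [CommRing R] (K : Matrix X X R) (B : Finset X) (u w : X) : R :=
  if h : u ∈ B ∧ w ∈ B then (K.submatrix (↑) (↑) : Matrix B B R)⁻¹ ⟨u, h.1⟩ ⟨w, h.2⟩ else 0

theorem blockInv_coe [CommRing R] (K : Matrix X X R) {B : Finset X} (u w : B) :
    blockInv K B u w = (K.submatrix (↑) (↑) : Matrix B B R)⁻¹ u w := by
  simp [blockInv]

theorem sum_blockInv_mul [CommRing R] {K : Matrix X X R} {B : Finset X}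
    (hB : IsUnit (K.submatrix (↑) (↑) : Matrix B B R).det) {u z : X} (hu : u ∈ B) (hz : z ∈ B) :
    ∑ w ∈ B, blockInv K B u w * K w z = if u = z then 1 else 0 := by
  have h := congrFun (congrFun (Matrix.nonsing_inv_mul _ hB) ⟨u, hu⟩) ⟨z, hz⟩
  rw [Matrix.mul_apply, Matrix.one_apply] at h
  simpa only [Subtype.mk.injEq, ← blockInv_coe, Matrix.submatrix_apply,
    Finset.sum_coe_sort B fun w => blockInv K B u w * K w z] using h

theorem sum_mul_blockInv [CommRing R] {K : Matrix X X R} {B : Finset X}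
    (hB : IsUnit (K.submatrix (↑) (↑) : Matrix B B R).det) {u z : X} (hu : u ∈ B) (hz : z ∈ B) :
    ∑ w ∈ B, K u w * blockInv K B w z = if u = z then 1 else 0 := by
  have h := congrFun (congrFun (Matrix.mul_nonsing_inv _ hB) ⟨u, hu⟩) ⟨z, hz⟩
  rw [Matrix.mul_apply, Matrix.one_apply] at h
  simpa only [Subtype.mk.injEq, ← blockInv_coe, Matrix.submatrix_apply,
    Finset.sum_coe_sort B fun w => K u w * blockInv K B w z] using h

theorem geometric_resolvent_identity [CommRing R] {K : Matrix X X R} {B Λ : Finset X}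
    (hBΛ : B ⊆ Λ) (hB : IsUnit (K.submatrix (↑) (↑) : Matrix B B R).det)
    (hΛ : IsUnit (K.submatrix (↑) (↑) : Matrix Λ Λ R).det)
    {u y : X} (hu : u ∈ B) (hy : y ∈ Λ) (hyB : y ∉ B) :
    blockInv K Λ u y =
      -∑ w ∈ B, ∑ z ∈ Λ \ B, blockInv K B u w * K w z * blockInv K Λ z y := by
  have hrow (w : X) (hw : w ∈ B) :
      ∑ z ∈ B, K w z * blockInv K Λ z y = -∑ z ∈ Λ \ B, K w z * blockInv K Λ z y := by
    have h := sum_mul_blockInv hΛ (hBΛ hw) hy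
    rw [if_neg (ne_of_mem_of_not_mem hw hyB), ← Finset.sum_sdiff hBΛ] at h
    exact eq_neg_of_add_eq_zero_right h
  calc blockInv K Λ u y = ∑ z ∈ B, (if u = z then 1 else 0) * blockInv K Λ z y := by simp [hu]
    _ = ∑ z ∈ B, ∑ w ∈ B, blockInv K B u w * (K w z * blockInv K Λ z y) := by
      refine Finset.sum_congr rfl fun z hz => ?_
      simp only [← sum_blockInv_mul hB hu hz, Finset.sum_mul, mul_assoc]
    _ = ∑ w ∈ B, blockInv K B u w * ∑ z ∈ B, K w z * blockInv K Λ z y := by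
      rw [Finset.sum_comm]
      simp only [Finset.mul_sum]
    _ = _ := by
      rw [← Finset.sum_neg_distrib]
      refine Finset.sum_congr rfl fun w hw => ?_
      simp only [hrow w hw, mul_neg, Finset.mul_sum, mul_assoc]

variable [NormedCommRing R]

/-- The site `u` of `Λ` lies in a block `B ⊆ Λ`, not containing `y`, for which the terms of the
geometric resolvent identity at `u` have relative size at most `θ` with respect to `W`. -/
def IsContractingAt (K : Matrix X X R) (Λ : Finset X) (y : X) (W : X → ℝ) (θ : ℝ) (u : X) : Prop :=
  ∃ B ⊆ Λ, IsUnit (K.submatrix (↑) (↑) : Matrix B B R).det ∧ u ∈ B ∧ y ∉ B ∧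
    ∀ w ∈ B, ∀ z ∈ Λ \ B, ‖blockInv K B u w‖ * ‖K w z‖ * W u ≤ θ * W z

theorem IsContractingAt.norm_blockInv_mul_le {K : Matrix X X R} {Λ : Finset X} {u y : X}
    {W : X → ℝ} {θ M : ℝ} (h : IsContractingAt K Λ y W θ u)
    (hΛ : IsUnit (K.submatrix (↑) (↑) : Matrix Λ Λ R).det) (hy : y ∈ Λ) (hW : 0 ≤ W u)
    (hθ : 0 ≤ θ) (hM0 : 0 ≤ M) (hM : ∀ z ∈ Λ, ‖blockInv K Λ z y‖ * W z ≤ M) :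
    ‖blockInv K Λ u y‖ * W u ≤ (Λ.card : ℝ) ^ 2 * θ * M := by
  obtain ⟨B, hBΛ, hB, hu, hyB, hterm⟩ := h
  have hle (w : X) (hw : w ∈ B) (z : X) (hz : z ∈ Λ \ B) :
      ‖blockInv K B u w * K w z * blockInv K Λ z y‖ * W u ≤ θ * M :=
    calc ‖blockInv K B u w * K w z * blockInv K Λ z y‖ * W u
        ≤ ‖blockInv K B u w‖ * ‖K w z‖ * ‖blockInv K Λ z y‖ * W u := by
          gcongr
          exact (norm_mul_le _ _).trans (by gcongr; exact norm_mul_le _ _)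
      _ = ‖blockInv K B u w‖ * ‖K w z‖ * W u * ‖blockInv K Λ z y‖ := by ring
      _ ≤ θ * W z * ‖blockInv K Λ z y‖ :=
          mul_le_mul_of_nonneg_right (hterm w hw z hz) (norm_nonneg _)
      _ = θ * (‖blockInv K Λ z y‖ * W z) := by ring
      _ ≤ θ * M := by gcongr; exact hM z (Finset.sdiff_subset hz)
  calc ‖blockInv K Λ u y‖ * W u
      ≤ (∑ w ∈ B, ∑ z ∈ Λ \ B, ‖blockInv K B u w * K w z * blockInv K Λ z y‖) * W u := by
        rw [geometric_resolvent_identity hBΛ hB hΛ hu hy hyB, norm_neg]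
        gcongr
        exact norm_sum_le_of_le _ fun _ _ => norm_sum_le _ _
    _ ≤ ∑ _ ∈ B, ∑ _ ∈ Λ \ B, θ * M := by
        simp only [Finset.sum_mul]
        exact Finset.sum_le_sum fun w hw => Finset.sum_le_sum fun z hz => hle w hw z hz
    _ = (B.card : ℝ) * (Λ \ B).card * (θ * M) := by
        simp only [Finset.sum_const, nsmul_eq_mul, mul_assoc]
    _ ≤ (Λ.card : ℝ) * Λ.card * (θ * M) := by
        gcongr
        exact Finset.sdiff_subset
    _ = (Λ.card : ℝ) ^ 2 * θ * M := by ring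

theorem norm_blockInv_mul_le_of_isContractingAt {K : Matrix X X R} {Λ : Finset X} {y : X}
    {W : X → ℝ} {θ C : ℝ} (hΛ : IsUnit (K.submatrix (↑) (↑) : Matrix Λ Λ R).det) (hy : y ∈ Λ)
    (hW : ∀ u, 0 ≤ W u) (hθ : 0 ≤ θ) (hcard : (Λ.card : ℝ) ^ 2 * θ < 1) (hC : 0 ≤ C)
    (h : ∀ u ∈ Λ, ‖blockInv K Λ u y‖ * W u ≤ C ∨ IsContractingAt K Λ y W θ u)
    {u : X} (hu : u ∈ Λ) : ‖blockInv K Λ u y‖ * W u ≤ C := by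
  obtain ⟨m, hm, hmax⟩ := Finset.exists_max_image Λ (fun u => ‖blockInv K Λ u y‖ * W u) ⟨u, hu⟩
  refine (hmax u hu).trans ?_
  rcases h m hm with hm_le | hcontr
  · exact hm_le
  · have hself := hcontr.norm_blockInv_mul_le hΛ hy (hW m) hθ
      (mul_nonneg (norm_nonneg _) (hW m)) hmax
    nlinarith [mul_nonneg (norm_nonneg (blockInv K Λ m y)) (hW m)]

end Resolvent

section Cover

variable {X : Type*} [PseudoMetricSpace X] {S : Set X}

/-- The closed balls of radius `r` centred at the points of `T ⊆ S` cover `S` and lie at mutual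
distance at least `g`. -/
structure IsSeparatedCover (S : Set X) (r g : ℝ) (T : Finset X) : Prop where
  subset : ↑T ⊆ S
  exists_dist_le : ∀ z ∈ S, ∃ t ∈ T, dist z t ≤ r
  separated : (T : Set X).Pairwise fun t t' => 2 * r + g ≤ dist t t'

theorem exists_finset_cover_of_not_exists_separated {r : ℝ} (n : ℕ)
    (h : ¬ ∃ s : Fin (n + 1) → X, (∀ i, s i ∈ S) ∧ Pairwise fun i j => r < dist (s i) (s j)) :
    ∃ T : Finset X, ↑T ⊆ S ∧ T.card ≤ n ∧ ∀ z ∈ S, ∃ t ∈ T, dist z t ≤ r := by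
  classical
  induction n with
  | zero =>
    refine ⟨∅, by simp, by simp, fun z hz => (h ⟨fun _ => z, fun _ => hz, fun i j hij => ?_⟩).elim⟩
    exact absurd (Subsingleton.elim (α := Fin 1) i j) hij
  | succ n ih =>
    by_cases hn : ∃ s : Fin (n + 1) → X, (∀ i, s i ∈ S) ∧ Pairwise fun i j => r < dist (s i) (s j)
    · obtain ⟨s, hsS, hs⟩ := hn
      refine ⟨Finset.univ.image s, by simpa [Set.subset_def] using hsS,
        Finset.card_image_le.trans (by simp), fun z hz => ?_⟩
      by_contra! hfar
      simp only [Finset.mem_image, Finset.mem_univ, true_and, forall_exists_index,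
        forall_apply_eq_imp_iff] at hfar
      refine h ⟨Fin.cons z s, Fin.cases hz hsS, fun i j hij => ?_⟩
      cases i using Fin.cases with
      | zero =>
        cases j using Fin.cases with
        | zero => exact absurd rfl hij
        | succ j => exact hfar j
      | succ i =>
        cases j using Fin.cases with
        | zero => rw [dist_comm]; exact hfar i
        | succ j => exact hs fun h => hij (congrArg Fin.succ h)
    · obtain ⟨T, hTS, hT, hcov⟩ := ih hn
      exact ⟨T, hTS, hT.trans n.le_succ, hcov⟩

theorem exists_isSeparatedCover_of_cover {r : ℕ → ℝ} {g : ℝ} (hr : ∀ i, 0 ≤ r i) (hg : 0 ≤ g)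
    (hstep : ∀ i, 3 * r i + g ≤ r (i + 1)) (n i : ℕ) {T : Finset X} (hTS : ↑T ⊆ S)
    (hT : T.card ≤ n + 1) (hcov : ∀ z ∈ S, ∃ t ∈ T, dist z t ≤ r i) :
    ∃ j ≤ n, ∃ T' ⊆ T, IsSeparatedCover S (r (i + j)) g T' := by
  classical
  induction n generalizing i T with
  | zero =>
    refine ⟨0, le_rfl, T, subset_rfl, hTS, hcov, fun t ht t' ht' hne => ?_⟩
    exact absurd (Finset.card_le_one.1 hT t ht t' ht') hne
  | succ n ih =>
    by_cases hsep : (T : Set X).Pairwise fun t t' => 2 * r i + g ≤ dist t t'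
    · exact ⟨0, Nat.zero_le _, T, subset_rfl, hTS, hcov, hsep⟩
    -- two balls that are too close are replaced by a larger one
    simp only [Set.Pairwise, Finset.mem_coe] at hsep
    push Not at hsep
    obtain ⟨t, ht, t', ht', hne, hclose⟩ := hsep
    have herase : T.erase t' ⊆ T := Finset.erase_subset _ _
    obtain ⟨j, hj, T', hT', hcover⟩ := ih (i + 1) (T := T.erase t')
      ((Finset.coe_subset.2 herase).trans hTS)
      (by rw [Finset.card_erase_of_mem ht']; omega) fun z hz => by
        obtain ⟨s, hs, hzs⟩ := hcov z hz
        by_cases hst : s = t'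
        · refine ⟨t, Finset.mem_erase.2 ⟨hne, ht⟩, ?_⟩
          have := dist_triangle_right z t t'
          subst hst
          linarith [hstep i]
        · exact ⟨s, Finset.mem_erase.2 ⟨hst, hs⟩, by linarith [hstep i, hr i]⟩
    refine ⟨j + 1, by omega, T', hT'.trans herase, ?_⟩
    rwa [add_right_comm, add_assoc] at hcover

end Cover

section Count

theorem count_le_count_add {p : ℕ → Prop} [DecidablePred p] {m n k : ℕ} (h : n ≤ m + k) :
    Nat.count p n ≤ Nat.count p m + k :=
  calc Nat.count p n ≤ Nat.count p (m + k) := Nat.count_monotone p h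
    _ ≤ Nat.count p m + k := by
      rw [Nat.count_add]
      exact Nat.add_le_add_left (Nat.count_le _) _

theorem count_le_count_of_forall_not {p : ℕ → Prop} [DecidablePred p] {m n : ℕ}
    (h : ∀ k, m ≤ k → k < n → ¬ p k) : Nat.count p n ≤ Nat.count p m := by
  simp only [Nat.count_eq_card_filter_range]
  refine Finset.card_le_card fun k hk => ?_
  simp only [Finset.mem_filter, Finset.mem_range] at hk ⊢
  exact ⟨not_le.1 fun hmk => h k hmk hk.1 hk.2, hk.2⟩

theorem le_count_notMem_add_card (A : Finset ℕ) (n : ℕ) : n ≤ Nat.count (· ∉ A) n + A.card := by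
  rw [Nat.count_eq_card_filter_range]
  calc n = (Finset.range n).card := (Finset.card_range n).symm
    _ = ((Finset.range n).filter (· ∉ A)).card + ((Finset.range n).filter (· ∈ A)).card := by
      rw [add_comm, Finset.card_filter_add_card_filter_not]
    _ ≤ ((Finset.range n).filter (· ∉ A)).card + A.card := by
      gcongr
      exact fun k hk => (Finset.mem_filter.1 hk).2

end Count

variable {d : ℕ} {γ ρ ρ' α κ ε₁ ε E : ℝ} {φ : (Fin d → ℤ) → ℂ} {v : (Fin d → ℤ) → ℝ}
  {l L r : ℕ} {x y u s t z : Fin d → ℤ}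

section Model

theorem IsHopping.isHermitian_restrict (hφ : IsHopping γ ρ φ) (ε : ℝ) (v : (Fin d → ℤ) → ℝ)
    (B : Finset (Fin d → ℤ)) : (restrict ε φ v B).IsHermitian := by
  ext i j
  have hswap : φ (i - j) = star (φ (j - i)) := hφ.hermitian i j
  rcases eq_or_ne i j with rfl | h
  · simpa [restrict, kernel] using Or.inl hswap.symm
  · simp [restrict, kernel, h, h.symm, hswap]

/-- The infinite matrix `H - E`. -/
noncomputable def shiftedKernel (ε : ℝ) (φ : (Fin d → ℤ) → ℂ) (v : (Fin d → ℤ) → ℝ) (E : ℝ) :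
    Matrix (Fin d → ℤ) (Fin d → ℤ) ℂ :=
  Matrix.of (kernel ε φ v) - (E : ℂ) • 1

theorem submatrix_shiftedKernel (ε : ℝ) (φ : (Fin d → ℤ) → ℂ) (v : (Fin d → ℤ) → ℝ) (E : ℝ)
    (B : Finset (Fin d → ℤ)) :
    ((shiftedKernel ε φ v E).submatrix (↑) (↑) : Matrix B B ℂ) =
      restrict ε φ v B - (E : ℂ) • 1 := by
  ext i j
  simp [shiftedKernel, restrict, Matrix.one_apply]

theorem blockInv_shiftedKernel_coe {B : Finset (Fin d → ℤ)} (u w : B) :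
    blockInv (shiftedKernel ε φ v E) B u w = green ε φ v B E u w := by
  rw [blockInv_coe, submatrix_shiftedKernel, green]

theorem isNR_iff_isBoundedBelow (hφ : IsHopping γ ρ φ) :
    IsNR ρ' ε φ v E L x ↔
      IsBoundedBelow (Real.exp (-(Real.log L ^ ρ'))) (restrict ε φ v (cube L x) - (E : ℂ) • 1) :=
  have : Nonempty (cube L x) := ⟨⟨x, self_mem_cube L x⟩⟩
  le_infDist_spectrum_iff_isBoundedBelow (hφ.isHermitian_restrict ε v _) _ (Real.exp_pos _).le

theorem IsNR.isUnit_det (hNR : IsNR ρ' ε φ v E L x) (hφ : IsHopping γ ρ φ) :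
    IsUnit ((shiftedKernel ε φ v E).submatrix (↑) (↑) : Matrix (cube L x) (cube L x) ℂ).det := by
  rw [submatrix_shiftedKernel]
  exact ((isNR_iff_isBoundedBelow hφ).1 hNR).isUnit_det (Real.exp_pos _)

theorem IsNR.norm_blockInv_le (hNR : IsNR ρ' ε φ v E L x) (hφ : IsHopping γ ρ φ)
    (u w : Fin d → ℤ) :
    ‖blockInv (shiftedKernel ε φ v E) (cube L x) u w‖ ≤ Real.exp (Real.log L ^ ρ') := by
  unfold blockInv
  split_ifs with h
  · rw [submatrix_shiftedKernel]
    refine (((isNR_iff_isBoundedBelow hφ).1 hNR).norm_inv_apply_le (Real.exp_pos _) _ _).trans ?_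
    rw [← Real.exp_neg, neg_neg]
  · simpa using (Real.exp_pos _).le

theorem IsHopping.norm_shiftedKernel_le (hφ : IsHopping γ ρ φ) (hρ : 0 < ρ) (hε : |ε| ≤ ε₁)
    {c : ℝ} (hc : 0 ≤ c) (hcγ : c ≤ γ) (hsz : s ≠ z) :
    ‖shiftedKernel ε φ v E s z‖ ≤
      ε₁ * Real.exp (c * (2 * ρ ^ ρ) - c * profile ρ (latticeDist s z)) := by
  have hφ_le := hφ.decay (s - z)
  rw [norm_sub_eq_latticeDist] at hφ_le
  have hlog := log_rpow_nonneg ρ (show (1 : ℝ) ≤ latticeDist s z + 1 by simp)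
  calc ‖shiftedKernel ε φ v E s z‖ = |ε| * ‖φ (s - z)‖ := by
        simp [shiftedKernel, kernel, hsz]
    _ ≤ ε₁ * Real.exp (c * (2 * ρ ^ ρ) - c * profile ρ (latticeDist s z)) := by
      refine mul_le_mul hε (hφ_le.trans (Real.exp_le_exp.2 ?_)) (norm_nonneg _)
        ((abs_nonneg ε).trans hε)
      have hprofile := mul_le_mul_of_nonneg_left
        (profile_le_log_rpow_add hρ (Nat.cast_nonneg (α := ℝ) (latticeDist s z))) hc
      nlinarith

theorem IsNR.norm_blockInv_mul_norm_le (hNR : IsNR ρ' ε φ v E r t) (hφ : IsHopping γ ρ φ)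
    (hρ : 0 < ρ) (hε : |ε| ≤ ε₁) {c : ℝ} (hc : 0 ≤ c) (hcγ : c ≤ γ) (hsz : s ≠ z) :
    ‖blockInv (shiftedKernel ε φ v E) (cube r t) u s‖ * ‖shiftedKernel ε φ v E s z‖ ≤
      ε₁ * Real.exp (c * (2 * ρ ^ ρ)) *
        Real.exp (Real.log r ^ ρ' - c * profile ρ (latticeDist s z)) := by
  refine (mul_le_mul (hNR.norm_blockInv_le hφ u s)
    (hφ.norm_shiftedKernel_le hρ hε hc hcγ hsz) (norm_nonneg _) (Real.exp_pos _).le).trans_eq ?_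
  rw [Real.exp_sub, Real.exp_sub]
  ring

theorem IsGood.norm_blockInv_le (hgood : IsGood ρ ρ' ε φ v κ E l u) (hρ : 0 < ρ) (hκ : 0 ≤ κ)
    (hs : s ∈ cube l u) (hfar : (l : ℝ) ^ (4 / 5 : ℝ) < latticeDist s u) :
    ‖blockInv (shiftedKernel ε φ v E) (cube l u) u s‖ ≤
      Real.exp (κ * (2 * ρ ^ ρ) - κ * profile ρ (latticeDist u s)) := by
  have hdecay := hgood.2 ⟨s, hs⟩ (by rwa [norm_sub_eq_latticeDist])
  rw [← blockInv_shiftedKernel_coe, norm_sub_eq_latticeDist] at hdecay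
  refine hdecay.trans (Real.exp_le_exp.2 ?_)
  have := mul_le_mul_of_nonneg_left
    (profile_le_log_rpow_add hρ (Nat.cast_nonneg (α := ℝ) (latticeDist u s))) hκ
  linarith

theorem profile_latticeDist_le_add (hρ : 0 < ρ) (u s z : Fin d → ℤ) :
    profile ρ (latticeDist u z) ≤ profile ρ (latticeDist u s) + profile ρ (latticeDist s z) :=
  (profile_mono hρ.le (Nat.cast_nonneg _) (by exact_mod_cast latticeDist_triangle u s z)).trans
    (profile_add_le hρ (Nat.cast_nonneg _) (Nat.cast_nonneg _))

/-- If `s` is far from the centre `u`, then the decay from `u` to `s` and the hop from `s` to `z`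
add up; if it is near, then the hop covers more than half of the way and its decay counts twice. -/
theorem IsGood.norm_blockInv_mul_norm_le (hgood : IsGood ρ ρ' ε φ v κ E l u)
    (hφ : IsHopping γ ρ φ) (hρ : 0 < ρ) (hε : |ε| ≤ ε₁) (hκ : 0 ≤ κ) (hκγ : 2 * κ ≤ γ)
    (hl : 1 ≤ l) (hnear : 2 * (l : ℝ) ^ (4 / 5 : ℝ) ≤ l) (hs : s ∈ cube l u) (hz : z ∉ cube l u) :
    ‖blockInv (shiftedKernel ε φ v E) (cube l u) u s‖ * ‖shiftedKernel ε φ v E s z‖ ≤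
      ε₁ * Real.exp (2 * κ * (2 * ρ ^ ρ)) *
        Real.exp (Real.log l ^ ρ' - κ * profile ρ (latticeDist u z)) := by
  have hsz : s ≠ z := ne_of_mem_of_not_mem hs hz
  have hε₁ : 0 ≤ ε₁ := (abs_nonneg ε).trans hε
  have hsub := mul_le_mul_of_nonneg_left (profile_latticeDist_le_add hρ u s z) hκ
  have hlog := log_rpow_nonneg ρ' (show (1 : ℝ) ≤ l by exact_mod_cast hl)
  rcases lt_or_ge ((l : ℝ) ^ (4 / 5 : ℝ)) (latticeDist s u) with hfar | hclose
  · refine (mul_le_mul (hgood.norm_blockInv_le hρ hκ hs hfar) (hφ.norm_shiftedKernel_le hρ hε hκ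
      (by linarith) hsz) (norm_nonneg _) (Real.exp_pos _).le).trans ?_
    rw [mul_left_comm, ← Real.exp_add, mul_assoc, ← Real.exp_add]
    refine mul_le_mul_of_nonneg_left (Real.exp_le_exp.2 ?_) hε₁
    have : 0 ≤ κ * (2 * ρ ^ ρ) := by positivity
    linarith
  · refine (hgood.1.norm_blockInv_mul_norm_le hφ hρ hε (by linarith) hκγ hsz).trans ?_
    refine mul_le_mul_of_nonneg_left (Real.exp_le_exp.2 ?_) (by positivity)
    have hhalf : 2 * latticeDist s u ≤ l := by
      have : 2 * (latticeDist s u : ℝ) ≤ l := by linarith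
      exact_mod_cast this
    have hle : latticeDist u s ≤ latticeDist s z := by
      rw [mem_cube_iff, latticeDist_comm] at hz
      have := latticeDist_triangle u s z
      rw [latticeDist_comm s u] at hhalf
      omega
    have := mul_le_mul_of_nonneg_left
      (profile_mono hρ.le (Nat.cast_nonneg _) (Nat.cast_le (α := ℝ).2 hle)) hκ
    linarith

end Model

section Iteration

variable {β τ a m : ℝ} {T : Finset (Fin d → ℤ)} {N₀ k : ℕ}

/-- The radii of the spheres about `x` that may meet one of the cubes `B_r(t)`, `t ∈ T`. -/
def shells (x : Fin d → ℤ) (r : ℕ) (T : Finset (Fin d → ℤ)) : Finset ℕ :=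
  T.biUnion fun t => Finset.Icc (latticeDist t x - r) (latticeDist t x + r)

/-- The distance from `x` to `u`, not counting the radii in `shells x r T`. -/
def freeDepth (x : Fin d → ℤ) (r : ℕ) (T : Finset (Fin d → ℤ)) (u : Fin d → ℤ) : ℕ :=
  Nat.count (· ∉ shells x r T) (latticeDist u x)

/-- The logarithm of the weight in the maximum principle for `G(·, y)`: the decay at rate `β` over
the remaining part `N₀ - freeDepth x r T u` of the way, with a penalty inside the cubes. -/
noncomputable def logWeight (β ρ m : ℝ) (x : Fin d → ℤ) (r : ℕ) (T : Finset (Fin d → ℤ)) (N₀ : ℕ)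
    (u : Fin d → ℤ) : ℝ :=
  β * profile ρ (N₀ - freeDepth x r T u : ℕ) - if u ∈ T.biUnion (cube r) then 3 * m else 0

theorem card_shells_le (x : Fin d → ℤ) (r : ℕ) (T : Finset (Fin d → ℤ)) :
    (shells x r T).card ≤ T.card * (2 * r + 1) := by
  refine Finset.card_biUnion_le_card_mul _ _ _ fun t _ => ?_
  rw [Nat.card_Icc]
  omega

theorem freeDepth_self (x : Fin d → ℤ) (r : ℕ) (T : Finset (Fin d → ℤ)) :
    freeDepth x r T x = 0 := by
  simp [freeDepth, latticeDist_self]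

theorem freeDepth_le_add (x : Fin d → ℤ) (r : ℕ) (T : Finset (Fin d → ℤ)) (u z : Fin d → ℤ) :
    freeDepth x r T z ≤ freeDepth x r T u + latticeDist u z := by
  refine count_le_count_add ?_
  rw [add_comm, latticeDist_comm u z]
  exact latticeDist_triangle z u x

theorem freeDepth_le_of_mem_cube (x : Fin d → ℤ) (ht : t ∈ T) (hu : u ∈ cube r t)
    (hs : s ∈ cube r t) : freeDepth x r T s ≤ freeDepth x r T u := by
  rw [mem_cube_iff] at hu hs
  have hsx := latticeDist_triangle s t x
  have htx := latticeDist_triangle t u x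
  rw [latticeDist_comm t u] at htx
  refine count_le_count_of_forall_not fun k huk hks => not_not.2 ?_
  exact Finset.mem_biUnion.2 ⟨t, ht, Finset.mem_Icc.2 ⟨by omega, by omega⟩⟩

theorem logWeight_add_le (hρ : 0 < ρ) (hβ : 0 ≤ β)
    (hk : freeDepth x r T z ≤ freeDepth x r T u + k)
    (h : a + (if z ∈ T.biUnion (cube r) then 3 * m else 0) + m ≤
      τ * profile ρ k + if u ∈ T.biUnion (cube r) then 3 * m else 0) :
    logWeight β ρ m x r T N₀ u + (a - (β + τ) * profile ρ k) ≤ logWeight β ρ m x r T N₀ z - m := by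
  have hdrop : profile ρ (N₀ - freeDepth x r T u : ℕ) ≤
      profile ρ (N₀ - freeDepth x r T z : ℕ) + profile ρ k :=
    (profile_mono hρ.le (Nat.cast_nonneg _) (by norm_cast; omega)).trans
      (profile_add_le hρ (Nat.cast_nonneg _) (Nat.cast_nonneg _))
  have := mul_le_mul_of_nonneg_left hdrop hβ
  unfold logWeight
  linarith

theorem mul_exp_le_mul_exp_of_add_le {b C w w' : ℝ} (hC : 0 ≤ C) (hb : b ≤ C * Real.exp a)
    (hw : w + a ≤ w' - m) : b * Real.exp w ≤ C * Real.exp (-m) * Real.exp w' :=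
  calc b * Real.exp w ≤ C * Real.exp a * Real.exp w := by gcongr
    _ = C * Real.exp (w + a) := by rw [Real.exp_add]; ring
    _ ≤ C * Real.exp (w' - m) := by gcongr
    _ = C * Real.exp (-m) * Real.exp w' := by rw [sub_eq_add_neg, Real.exp_add]; ring

theorem isContractingAt_of_isGood (hφ : IsHopping γ ρ φ) (hρ : 0 < ρ) (hε : |ε| ≤ ε₁)
    (hκγ : 2 * κ ≤ γ) (hτ : 0 ≤ τ) (hτκ : τ ≤ κ) (hl : 1 ≤ l)
    (hnear : 2 * (l : ℝ) ^ (4 / 5 : ℝ) ≤ l) (hfar : 5 * Real.log l ^ ρ' ≤ τ * profile ρ l)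
    (N₀ : ℕ) (hgood : IsGood ρ ρ' ε φ v κ E l u) (hu : u ∉ T.biUnion (cube r))
    (huL : latticeDist u x + l ≤ L) (hy : y ∉ cube l u) :
    IsContractingAt (shiftedKernel ε φ v E) (cube L x) y
      (fun u => Real.exp (logWeight (κ - τ) ρ (Real.log l ^ ρ') x r T N₀ u))
      (ε₁ * Real.exp (2 * κ * (2 * ρ ^ ρ)) * Real.exp (-(Real.log l ^ ρ'))) u := by
  have hε₁ : 0 ≤ ε₁ := (abs_nonneg ε).trans hε
  have hm := log_rpow_nonneg ρ' (show (1 : ℝ) ≤ l by exact_mod_cast hl)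
  refine ⟨cube l u, fun z hz => ?_, hgood.1.isUnit_det hφ, self_mem_cube l u, hy,
    fun s hs z hz => ?_⟩
  · rw [mem_cube_iff] at hz ⊢
    linarith [latticeDist_triangle z u x]
  · have hzu := (Finset.mem_sdiff.1 hz).2
    refine mul_exp_le_mul_exp_of_add_le (by positivity) (hgood.norm_blockInv_mul_norm_le hφ hρ hε
      (hτ.trans hτκ) hκγ hl hnear hs hzu) ?_
    rw [mem_cube_iff, latticeDist_comm, not_le] at hzu
    have hpay : τ * profile ρ l ≤ τ * profile ρ (latticeDist u z) :=
      mul_le_mul_of_nonneg_left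
        (profile_mono hρ.le (Nat.cast_nonneg _) (by exact_mod_cast hzu.le)) hτ
    rw [← sub_add_cancel κ τ, add_sub_cancel_right]
    refine logWeight_add_le hρ (by linarith) (freeDepth_le_add x r T u z) ?_
    rw [if_neg hu]
    split_ifs <;> linarith

theorem isContractingAt_of_mem_cube (hφ : IsHopping γ ρ φ) (hρ : 0 < ρ) (hε : |ε| ≤ ε₁)
    (hκγ : 2 * κ ≤ γ) (hτ : 0 ≤ τ) (hτκ : τ ≤ κ) (hfar : 3 * m ≤ τ * profile ρ l)
    (hr : Real.log r ^ ρ' ≤ 2 * m)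
    (hsep : (T : Set (Fin d → ℤ)).Pairwise fun t t' => 2 * r + l ≤ latticeDist t t') (N₀ : ℕ)
    (ht : t ∈ T) (hu : u ∈ cube r t) (hNR : IsNR ρ' ε φ v E r t)
    (htL : latticeDist t x + r ≤ L) (hy : y ∉ cube r t) :
    IsContractingAt (shiftedKernel ε φ v E) (cube L x) y
      (fun u => Real.exp (logWeight (κ - τ) ρ m x r T N₀ u))
      (ε₁ * Real.exp (2 * κ * (2 * ρ ^ ρ)) * Real.exp (-m)) u := by
  have hε₁ : 0 ≤ ε₁ := (abs_nonneg ε).trans hε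
  refine ⟨cube r t, fun z hz => ?_, hNR.isUnit_det hφ, hu, hy, fun s hs z hz => ?_⟩
  · rw [mem_cube_iff] at hz ⊢
    linarith [latticeDist_triangle z t x]
  · have hzt := (Finset.mem_sdiff.1 hz).2
    have hP := profile_nonneg hρ.le (Nat.cast_nonneg (α := ℝ) (latticeDist s z))
    have hblock := hNR.norm_blockInv_mul_norm_le (u := u) hφ hρ hε (by linarith) hκγ
      (ne_of_mem_of_not_mem hs hzt)
    refine mul_exp_le_mul_exp_of_add_le (a := 2 * m - κ * profile ρ (latticeDist s z))
      (by positivity)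
      (hblock.trans (mul_le_mul_of_nonneg_left (Real.exp_le_exp.2 ?_) (by positivity))) ?_
    · nlinarith
    rw [← sub_add_cancel κ τ, add_sub_cancel_right]
    refine logWeight_add_le hρ (by linarith) ((freeDepth_le_add x r T s z).trans
      (Nat.add_le_add_right (freeDepth_le_of_mem_cube x ht hu hs) _)) ?_
    rw [if_pos (Finset.mem_biUnion.2 ⟨t, ht, hu⟩)]
    have hτP := mul_nonneg hτ hP
    split_ifs with hz'
    · have hle : l ≤ latticeDist s z := by
        obtain ⟨t', ht', hzt'⟩ := Finset.mem_biUnion.1 hz'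
        have htt' := hsep ht ht' (by rintro rfl; exact hzt hzt')
        rw [mem_cube_iff] at hs hzt'
        have h₁ := latticeDist_triangle t s t'
        have h₂ := latticeDist_triangle s z t'
        rw [latticeDist_comm t s] at h₁
        omega
      have := mul_le_mul_of_nonneg_left
        (profile_mono hρ.le (Nat.cast_nonneg _) (Nat.cast_le (α := ℝ).2 hle)) hτ
      linarith
    · linarith

theorem logWeight_le (hm : 0 ≤ m) (h : N₀ ≤ freeDepth x r T u) :
    logWeight β ρ m x r T N₀ u ≤ β * profile ρ 0 := by
  rw [logWeight, Nat.sub_eq_zero_of_le h, Nat.cast_zero]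
  split_ifs <;> linarith

theorem le_logWeight_self (hm : 0 ≤ m) :
    β * profile ρ N₀ - 3 * m ≤ logWeight β ρ m x r T N₀ x := by
  rw [logWeight, freeDepth_self, Nat.sub_zero]
  split_ifs <;> linarith

theorem norm_blockInv_cube_le (hφ : IsHopping γ ρ φ) (hρ : 0 < ρ) (hε : |ε| ≤ ε₁)
    (hκγ : 2 * κ ≤ γ) (hτ : 0 ≤ τ) (hτκ : τ ≤ κ) (hl : 1 ≤ l)
    (hnear : 2 * (l : ℝ) ^ (4 / 5 : ℝ) ≤ l) (hfar : 5 * Real.log l ^ ρ' ≤ τ * profile ρ l)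
    (hr : Real.log r ^ ρ' ≤ 2 * Real.log l ^ ρ')
    (hcard : ((cube L x).card : ℝ) ^ 2 *
      (ε₁ * Real.exp (2 * κ * (2 * ρ ^ ρ)) * Real.exp (-(Real.log l ^ ρ'))) < 1)
    (hsep : (T : Set (Fin d → ℤ)).Pairwise fun t t' => 2 * r + l ≤ latticeDist t t')
    (hbad : ∀ u ∈ cube L x, ¬ IsGood ρ ρ' ε φ v κ E l u → u ∈ T.biUnion (cube r))
    (hNRT : ∀ t ∈ T, IsNR ρ' ε φ v E r t) (hNR : IsNR ρ' ε φ v E L x) (hy : y ∈ cube L x) :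
    ‖blockInv (shiftedKernel ε φ v E) (cube L x) x y‖ ≤
      Real.exp (3 * Real.log l ^ ρ' + Real.log L ^ ρ' + (κ - τ) * profile ρ 0 - (κ - τ) *
        profile ρ (Nat.count (· ∉ shells x r T) (latticeDist y x - (2 * r + l)))) := by
  set m := Real.log l ^ ρ'
  have hm : 0 ≤ m := log_rpow_nonneg ρ' (by exact_mod_cast hl)
  have hε₁ : 0 ≤ ε₁ := (abs_nonneg ε).trans hε
  set N₀ := Nat.count (· ∉ shells x r T) (latticeDist y x - (2 * r + l))
  have hyL : latticeDist y x ≤ L := mem_cube_iff.1 hy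
  have hweighted := norm_blockInv_mul_le_of_isContractingAt
    (W := fun u => Real.exp (logWeight (κ - τ) ρ m x r T N₀ u))
    (C := Real.exp (Real.log L ^ ρ' + (κ - τ) * profile ρ 0))
    (hNR.isUnit_det hφ) hy (fun u => (Real.exp_pos _).le) (by positivity) hcard
    (Real.exp_pos _).le (fun u hu => ?_) (self_mem_cube L x)
  · rw [← le_div_iff₀ (Real.exp_pos _), ← Real.exp_sub] at hweighted
    refine hweighted.trans (Real.exp_le_exp.2 ?_)
    linarith [le_logWeight_self (β := κ - τ) (ρ := ρ) (x := x) (r := r) (T := T) (N₀ := N₀) hm]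
  rcases le_or_gt N₀ (freeDepth x r T u) with hdeep | hshallow
  · left
    rw [Real.exp_add]
    exact mul_le_mul (hNR.norm_blockInv_le hφ u y)
      (Real.exp_le_exp.2 (logWeight_le hm hdeep)) (Real.exp_pos _).le
      (Real.exp_pos _).le
  right
  have hux : latticeDist u x + (2 * r + l) < latticeDist y x := by
    by_contra hle
    exact hshallow.not_ge (Nat.count_monotone _ (by omega))
  by_cases hub : u ∈ T.biUnion (cube r)
  · obtain ⟨t, ht, hut⟩ := Finset.mem_biUnion.1 hub
    have hut' := mem_cube_iff.1 hut
    refine isContractingAt_of_mem_cube hφ hρ hε hκγ hτ hτκ (by linarith) hr hsep N₀ ht hut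
      (hNRT t ht) ?_ fun hyt => ?_
    · have := latticeDist_triangle t u x
      rw [latticeDist_comm t u] at this
      omega
    · have h₁ := latticeDist_triangle y t x
      have h₂ := latticeDist_triangle t u x
      rw [mem_cube_iff] at hyt
      rw [latticeDist_comm t u] at h₂
      omega
  · refine isContractingAt_of_isGood hφ hρ hε hκγ hτ hτκ hl hnear hfar N₀
      (not_imp_comm.1 (hbad u hu) hub) hub (by omega) fun hyu => ?_
    have := latticeDist_triangle y u x
    rw [mem_cube_iff] at hyu
    omega

end Iteration

section InductionStep

/-- The requirements on the scales `l` and `L = ⌊l ^ α⌋` under which the deterministic induction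
step works for all hopping strengths up to `ε₁`. -/
structure IsLargeScale (d : ℕ) (ρ ρ' α κ ε₁ : ℝ) (l L : ℕ) : Prop where
  one_le : 1 ≤ l
  le_log : 20 * ρ ≤ Real.log l
  two_mul_rpow_le : 2 * (l : ℝ) ^ (4 / 5 : ℝ) ≤ l
  log_mul_rpow_le : Real.log (26 * l : ℕ) ^ ρ' ≤ 2 * Real.log l ^ ρ'
  mul_rpow_le_log : κ * ρ ^ ρ ≤ Real.log l ^ ρ'
  absorb : ε₁ * Real.exp (2 * κ * (2 * ρ ^ ρ)) * (((2 * L + 1) ^ d : ℕ) : ℝ) ^ 2 <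
    Real.exp (Real.log l ^ ρ')
  le_rpow : 500 * (l : ℝ) ≤ (L : ℝ) ^ (4 / 5 : ℝ)
  rpow_le : (l : ℝ) ^ (4 / 5 * α) ≤ 2 * (L : ℝ) ^ (4 / 5 : ℝ)
  log_le : Real.log L ≤ 2 * Real.log l

theorem one_sub_div_log_le_log_sub_div_log {s t : ℝ} (hs : 0 ≤ s) (hst : 2 * s ≤ t) (ht : 1 < t) :
    1 - 2 * (s / t) / Real.log t ≤ Real.log (t - s) / Real.log t := by
  have ht0 : 0 < t := one_pos.trans ht
  have hratio : s / t ≤ 1 / 2 := by rw [div_le_div_iff₀ ht0 two_pos]; linarith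
  have hpos : 0 < 1 - s / t := by linarith
  have hlog : Real.log (t - s) = Real.log t + Real.log (1 - s / t) := by
    rw [← Real.log_mul ht0.ne' hpos.ne', mul_sub, mul_div_cancel₀ _ ht0.ne', mul_one]
  have hinv : (1 - s / t)⁻¹ ≤ 1 + 2 * (s / t) := by
    rw [inv_le_iff_one_le_mul₀ hpos]
    nlinarith [div_nonneg hs ht0.le]
  rw [one_sub_div (Real.log_pos ht).ne', div_le_div_iff_of_pos_right (Real.log_pos ht), hlog]
  linarith [Real.one_sub_inv_le_log_of_pos hpos]

theorem one_sub_mul_log_rpow_le {s t : ℝ} (hρ : 1 ≤ ρ) (hs : 0 ≤ s) (hst : 2 * s ≤ t)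
    (ht : 1 ≤ Real.log t) (ht0 : 0 ≤ t) :
    (1 - 2 * ρ * (s / t) / Real.log t) * Real.log t ^ ρ ≤ Real.log (t - s) ^ ρ := by
  have ht1 : 1 < t := (Real.log_pos_iff ht0).1 (by linarith)
  have hratio : 2 * (s / t) / Real.log t ≤ 1 := by
    rw [div_le_one (by linarith), ← mul_div_assoc, div_le_iff₀ (by linarith)]
    nlinarith
  have hlog := one_sub_div_log_le_log_sub_div_log hs hst ht1
  have hnonneg : 0 ≤ Real.log (t - s) := by
    simpa using (le_div_iff₀ (by linarith)).1 ((by linarith : (0 : ℝ) ≤ _).trans hlog)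
  calc (1 - 2 * ρ * (s / t) / Real.log t) * Real.log t ^ ρ
      = (1 + ρ * -(2 * (s / t) / Real.log t)) * Real.log t ^ ρ := by ring
    _ ≤ (1 + -(2 * (s / t) / Real.log t)) ^ ρ * Real.log t ^ ρ := by
      gcongr
      exact one_add_mul_self_le_rpow_one_add (by linarith) hρ
    _ ≤ (Real.log (t - s) / Real.log t) ^ ρ * Real.log t ^ ρ := by
      gcongr <;> linarith
    _ = Real.log (t - s) ^ ρ := by
      rw [Real.div_rpow hnonneg (by linarith), div_mul_cancel₀]
      exact (Real.rpow_pos_of_pos (by linarith) _).ne'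

theorem sub_mul_log_rpow_le_mul_profile {β a R Q q : ℝ} (hρ : 1 ≤ ρ) (hβ : 0 ≤ β)
    (hβγ : 5 * β ≤ γ) (ha : 0 ≤ a) (hlog : 20 * ρ ≤ Real.log R) (hR : 500 * a ≤ R) (hq : 0 < q)
    (hqR : a * q ≤ 2 * R) (hRQ : R ≤ Q + 250 * a) :
    (β - γ * (10 / q)) * Real.log (R + 1) ^ ρ ≤ β * profile ρ Q := by
  have hR0 : 0 ≤ R := by linarith
  have hRpos : 0 < R := hR0.lt_of_ne' (by rintro rfl; simp at hlog; linarith)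
  have hlogR : 20 * ρ ≤ Real.log (R + 1) := hlog.trans (Real.log_le_log hRpos (by linarith))
  have hshell : a / (R + 1) ≤ 2 / q := by
    rw [div_le_div_iff₀ (by linarith) hq]
    linarith
  have hslope : 2 * ρ / Real.log (R + 1) ≤ 1 / 10 := by
    rw [div_le_div_iff₀ (by linarith) (by norm_num)]
    linarith
  have hslope0 : 0 ≤ 2 * ρ / Real.log (R + 1) := div_nonneg (by linarith) (by linarith)
  have hloss : β * (2 * ρ * (250 * a / (R + 1)) / Real.log (R + 1)) ≤ γ * (10 / q) :=
    calc β * (2 * ρ * (250 * a / (R + 1)) / Real.log (R + 1))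
        = β * (250 * ((2 * ρ / Real.log (R + 1)) * (a / (R + 1)))) := by ring
      _ ≤ γ / 5 * (250 * (1 / 10 * (2 / q))) := by gcongr <;> linarith
      _ = γ * (10 / q) := by ring
  calc (β - γ * (10 / q)) * Real.log (R + 1) ^ ρ
      ≤ β * ((1 - 2 * ρ * (250 * a / (R + 1)) / Real.log (R + 1)) * Real.log (R + 1) ^ ρ) := by
        rw [← mul_assoc]
        refine mul_le_mul_of_nonneg_right ?_ (log_rpow_nonneg ρ (by linarith))
        linarith
    _ ≤ β * Real.log (R + 1 - 250 * a) ^ ρ := by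
      gcongr
      exact one_sub_mul_log_rpow_le hρ (by linarith) (by linarith) (by linarith) (by linarith)
    _ ≤ β * profile ρ Q := by
      gcongr
      exact (log_rpow_mono (by linarith) (by linarith) (by linarith)).trans
        (log_rpow_le_profile (by linarith) (by linarith))

theorem IsLargeScale.log_pos (hS : IsLargeScale d ρ ρ' α κ ε₁ l L) (hρ : 0 < ρ) :
    0 < Real.log l := by
  linarith [hS.le_log]

theorem IsLargeScale.log_rpow_le (hS : IsLargeScale d ρ ρ' α κ ε₁ l L) (hρ' : 0 < ρ')
    (hρ : ρ' ≤ ρ) : Real.log L ^ ρ' ≤ 2 ^ ρ * Real.log l ^ ρ' :=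
  calc Real.log L ^ ρ' ≤ (2 * Real.log l) ^ ρ' :=
        Real.rpow_le_rpow (Real.log_natCast_nonneg L) hS.log_le hρ'.le
    _ = 2 ^ ρ' * Real.log l ^ ρ' := Real.mul_rpow two_pos.le (Real.log_natCast_nonneg l)
    _ ≤ 2 ^ ρ * Real.log l ^ ρ' := by
      refine mul_le_mul_of_nonneg_right ?_ (Real.rpow_nonneg (Real.log_natCast_nonneg l) _)
      exact Real.rpow_le_rpow_of_exponent_le one_le_two hρ

theorem log_rpow_le_div (hl : 0 < Real.log l) (hρ : 0 ≤ ρ) {R : ℝ} (hR : l ≤ R) :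
    Real.log l ^ ρ' ≤ Real.log (R + 1) ^ ρ / Real.log l ^ (ρ - ρ') := by
  rw [le_div_iff₀ (Real.rpow_pos_of_pos hl _), ← Real.rpow_add hl, add_sub_cancel]
  have hl1 : 1 < (l : ℝ) := (Real.log_pos_iff (Nat.cast_nonneg l)).1 hl
  exact log_rpow_mono hρ hl1.le (by linarith)

theorem exponent_le_neg_nextRate_mul (hρ' : 1 < ρ') (hρ : ρ' < ρ) (hκ : 0 ≤ κ) (hγ : 5 * κ ≤ γ)
    (hS : IsLargeScale d ρ ρ' α κ ε₁ l L) (hmin : 5 / Real.log l ^ (ρ - ρ') ≤ κ) {R Q : ℝ}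
    (hR : (L : ℝ) ^ (4 / 5 : ℝ) ≤ R) (hRQ : R ≤ Q + 250 * l) :
    3 * Real.log l ^ ρ' + Real.log L ^ ρ' +
        (κ - 5 / Real.log l ^ (ρ - ρ')) * profile ρ 0 -
        (κ - 5 / Real.log l ^ (ρ - ρ')) * profile ρ Q ≤
      -nextRate γ ρ ρ' α κ l * Real.log (R + 1) ^ ρ := by
  have hlog : 0 < Real.log l := hS.log_pos (by linarith)
  have hl1 : (1 : ℝ) ≤ l := by exact_mod_cast hS.one_le
  have hlR : 500 * (l : ℝ) ≤ R := hS.le_rpow.trans hR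
  set m := Real.log l ^ ρ'
  set D := Real.log l ^ (ρ - ρ')
  set F := Real.log (R + 1) ^ ρ
  have hD : 0 < D := Real.rpow_pos_of_pos hlog _
  have hF : 0 ≤ F := log_rpow_nonneg ρ (by linarith)
  have hmF : m ≤ F / D := log_rpow_le_div hlog (by linarith) (by linarith)
  have hFD : 0 ≤ F / D := by positivity
  have hτ : 0 ≤ 5 / D := div_nonneg (by norm_num) hD.le
  have hmain : (κ - 5 / D - γ * (10 / (l : ℝ) ^ (4 / 5 * α - 1))) * F ≤
      (κ - 5 / D) * profile ρ Q := by
    refine sub_mul_log_rpow_le_mul_profile (a := l) (by linarith) (by linarith) (by linarith)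
      (by linarith) (hS.le_log.trans (Real.log_le_log (by linarith) (by linarith))) hlR
      (by positivity) ?_ hRQ
    rw [Real.rpow_sub_one (by linarith), mul_div_cancel₀ _ (by linarith)]
    linarith [hS.rpow_le]
  have hL : Real.log L ^ ρ' ≤ 2 ^ ρ * (F / D) :=
    (hS.log_rpow_le (by linarith) hρ.le).trans (by gcongr)
  have hzero : (κ - 5 / D) * profile ρ 0 ≤ m := by
    rw [profile_zero]
    exact (mul_le_mul_of_nonneg_right (by linarith) (Real.rpow_nonneg (by linarith) _)).trans
      hS.mul_rpow_le_log
  have hrest : 0 ≤ γ * (10 / Real.log l ^ (ρ - 1)) * F := by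
    have : 0 ≤ γ := by linarith
    positivity
  have hexpand : nextRate γ ρ ρ' α κ l * F = (κ - 5 / D - γ * (10 / (l : ℝ) ^ (4 / 5 * α - 1))) * F
      - γ * (10 / Real.log l ^ (ρ - 1)) * F - 25 * (F / D) - 2 ^ ρ * (F / D) := by
    simp only [nextRate, D]
    ring
  linarith

theorem exists_separated_cubes {S : Set (Fin d → ℤ)} (l : ℕ)
    (h : ¬ ∃ s : Fin 4 → Fin d → ℤ, (∀ i, s i ∈ S) ∧
      Pairwise fun i j => 2 * (l : ℝ) < dist (s i) (s j)) :
    ∃ T : Finset (Fin d → ℤ), ∃ r : ℕ, (r = 2 * l ∨ r = 8 * l ∨ r = 26 * l) ∧ ↑T ⊆ S ∧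
      T.card ≤ 3 ∧ (∀ u ∈ S, u ∈ T.biUnion (cube r)) ∧
      (T : Set (Fin d → ℤ)).Pairwise fun t t' => 2 * r + l ≤ latticeDist t t' := by
  obtain ⟨T₀, hT₀S, hT₀, hcov⟩ := exists_finset_cover_of_not_exists_separated 3 h
  obtain ⟨j, hj, T, hT, hcover⟩ := exists_isSeparatedCover_of_cover
    (r := fun i => (3 ^ (i + 1) - 1) * (l : ℝ)) (g := l)
    (fun i => mul_nonneg (sub_nonneg.2 (one_le_pow₀ (by norm_num))) (Nat.cast_nonneg l))
    (Nat.cast_nonneg l)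
    (fun i => by rw [pow_succ _ (i + 1)]; nlinarith [Nat.cast_nonneg (α := ℝ) l]) 2 0 hT₀S hT₀
    (by norm_num; exact hcov)
  obtain ⟨r, hr, hradius⟩ : ∃ r : ℕ, (r = 2 * l ∨ r = 8 * l ∨ r = 26 * l) ∧
      (3 ^ (0 + j + 1) - 1) * (l : ℝ) = r := by
    interval_cases j
    · exact ⟨2 * l, by simp, by norm_num⟩
    · exact ⟨8 * l, by simp, by norm_num⟩
    · exact ⟨26 * l, by simp, by norm_num⟩
  simp only [hradius] at hcover
  refine ⟨T, r, hr, hcover.subset, (Finset.card_le_card hT).trans hT₀, fun u hu => ?_,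
    fun t ht t' ht' hne => ?_⟩
  · obtain ⟨t, ht, hut⟩ := hcover.exists_dist_le u hu
    rw [dist_eq_latticeDist] at hut
    exact Finset.mem_biUnion.2 ⟨t, ht, mem_cube_iff.2 (by exact_mod_cast hut)⟩
  · have : 2 * (r : ℝ) + l ≤ dist t t' := hcover.separated ht ht' hne
    rw [dist_eq_latticeDist] at this
    exact_mod_cast this

theorem isNR_of_not_hasResonance (h : ¬ HasResonance ρ' ε φ v l L E x) (hz : z ∈ cube L x)
    (hr : r = 2 * l ∨ r = 8 * l ∨ r = 26 * l) : IsNR ρ' ε φ v E r z := by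
  simp only [HasResonance, not_or, not_not, not_exists, not_and] at h
  obtain ⟨h₂, h₈, h₂₆⟩ := h.2 z hz
  rcases hr with rfl | rfl | rfl <;> assumption

theorem isGood_nextRate_of_few_bad (hρ' : 1 < ρ') (hρ : ρ' < ρ) (hκ : 0 ≤ κ) (hγ : 5 * κ ≤ γ)
    (hφ : IsHopping γ ρ φ) (hε : |ε| ≤ ε₁) (hS : IsLargeScale d ρ ρ' α κ ε₁ l L)
    (hmin : 5 / Real.log l ^ (ρ - ρ') ≤ κ) (hres : ¬ HasResonance ρ' ε φ v l L E x)
    (hbad : ¬ ∃ s : Fin 4 → Fin d → ℤ, (∀ i, s i ∈ cube L x ∧ ¬ IsGood ρ ρ' ε φ v κ E l (s i)) ∧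
      Pairwise fun i j => 2 * (l : ℝ) < dist (s i) (s j)) :
    IsGood ρ ρ' ε φ v (nextRate γ ρ ρ' α κ l) E L x := by
  obtain ⟨T, r, hr, hTS, hTcard, hcov, hsep⟩ :=
    exists_separated_cubes (S := {u | u ∈ cube L x ∧ ¬ IsGood ρ ρ' ε φ v κ E l u}) l hbad
  have hNR : IsNR ρ' ε φ v E L x := not_not.1 (not_or.1 hres).1
  refine ⟨hNR, fun y hfar => ?_⟩
  have hl1 : (1 : ℝ) ≤ l := by exact_mod_cast hS.one_le
  have hlog : 0 < Real.log l := hS.log_pos (by linarith)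
  have hD : 0 < Real.log l ^ (ρ - ρ') := Real.rpow_pos_of_pos hlog _
  have hrl : r ≤ 26 * l := by omega
  rw [norm_sub_eq_latticeDist] at hfar
  rw [← blockInv_shiftedKernel_coe, norm_sub_eq_latticeDist, latticeDist_comm]
  refine (norm_blockInv_cube_le (τ := 5 / Real.log l ^ (ρ - ρ')) hφ (by linarith) hε (by linarith)
    (by positivity) hmin hS.one_le hS.two_mul_rpow_le ?_ ?_ ?_ hsep
    (fun u hu hubad => hcov u ⟨hu, hubad⟩) (fun t ht => isNR_of_not_hasResonance hres (hTS ht).1 hr)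
    hNR y.2).trans (Real.exp_le_exp.2
      (exponent_le_neg_nextRate_mul hρ' hρ hκ hγ hS hmin hfar.le ?_))
  · rw [div_mul_eq_mul_div, mul_div_assoc]
    gcongr
    exact (log_rpow_le_div hlog (by linarith) le_rfl).trans
      (div_le_div_of_nonneg_right (log_rpow_le_profile (by linarith) (by linarith)) hD.le)
  · refine le_trans (log_rpow_mono (by linarith) ?_ ?_) hS.log_mul_rpow_le
    · exact_mod_cast (show 1 ≤ r by have := hS.one_le; omega)
    · exact_mod_cast hrl
  · rw [card_cube, mul_comm, mul_right_comm, Real.exp_neg, ← div_eq_mul_inv,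
      div_lt_one (Real.exp_pos _)]
    exact hS.absorb
  · have hcount := le_count_notMem_add_card (shells x r T) (latticeDist y x - (2 * r + l))
    have hshells := (card_shells_le x r T).trans (Nat.mul_le_mul_right _ hTcard)
    have hl := hS.one_le
    norm_cast
    omega

end InductionStep

section PotentialDependence

theorem continuous_restrict (ε : ℝ) (φ : (Fin d → ℤ) → ℂ) (B : Finset (Fin d → ℤ)) :
    Continuous fun v => restrict ε φ v B := by
  refine continuous_matrix fun i j => continuous_const.add ?_
  split_ifs
  · exact Complex.continuous_ofReal.comp (continuous_apply _)
  · exact continuous_const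

theorem isClosed_setOf_isGood (hφ : IsHopping γ ρ φ) (ρ' ε κ E : ℝ) (L : ℕ) (x : Fin d → ℤ) :
    IsClosed {v | IsGood ρ ρ' ε φ v κ E L x} := by
  let A (v : (Fin d → ℤ) → ℝ) := restrict ε φ v (cube L x) - (E : ℂ) • 1
  have hA : Continuous A := (continuous_restrict ε φ _).sub continuous_const
  -- Cramer's rule turns the bound on the inverse into a closed condition.
  have hcramer : {v | IsGood ρ ρ' ε φ v κ E L x} =
      {v | IsBoundedBelow (Real.exp (-(Real.log L ^ ρ'))) (A v)} ∩
        ⋂ y : cube L x, ⋂ _ : (L : ℝ) ^ (4 / 5 : ℝ) < ‖(y : Fin d → ℤ) - x‖,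
          {v | ‖(A v).adjugate ⟨x, self_mem_cube L x⟩ y‖ ≤
            Real.exp (-κ * Real.log (‖x - (y : Fin d → ℤ)‖ + 1) ^ ρ) * ‖(A v).det‖} := by
    ext v
    simp only [Set.mem_inter_iff, Set.mem_iInter, Set.mem_ofPred_eq, IsGood,
      isNR_iff_isBoundedBelow hφ]
    refine and_congr_right fun hbdd => forall_congr' fun y => imp_congr_right fun _ => ?_
    have hdet : 0 < ‖(A v).det‖ := norm_pos_iff.2 (hbdd.isUnit_det (Real.exp_pos _)).ne_zero
    rw [green, Matrix.inv_def, Matrix.smul_apply, smul_eq_mul, norm_mul, Ring.inverse_eq_inv',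
      norm_inv, inv_mul_le_iff₀ hdet, mul_comm]
  rw [hcramer]
  refine (isClosed_setOf_isBoundedBelow hA _).inter
    (isClosed_iInter fun y => isClosed_iInter fun _ => isClosed_le (Continuous.norm ?_)
      (continuous_const.mul hA.matrix_det.norm))
  exact hA.matrix_adjugate.matrix_elem _ _

theorem dependsOn_isGood (ρ ρ' ε : ℝ) (φ : (Fin d → ℤ) → ℂ) (κ E : ℝ) (L : ℕ)
    (x : Fin d → ℤ) : DependsOn (fun v => IsGood ρ ρ' ε φ v κ E L x) (cube L x) := by
  intro v v' h
  have hrestrict : restrict ε φ v (cube L x) = restrict ε φ v' (cube L x) := by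
    ext i j
    simp only [restrict, Matrix.of_apply, kernel, h i i.2]
  simp only [IsGood, IsNR, green, hrestrict]

/-- The potentials for which `B_l(a)` and `B_l(b)` are both bad at some energy in `I`. -/
def badPair (ρ ρ' ε : ℝ) (φ : (Fin d → ℤ) → ℂ) (κ : ℝ) (I : Set ℝ) (l : ℕ)
    (a b : Fin d → ℤ) : Set ((Fin d → ℤ) → ℝ) :=
  {v | ∃ E ∈ I, ¬ IsGood ρ ρ' ε φ v κ E l a ∧ ¬ IsGood ρ ρ' ε φ v κ E l b}

theorem isOpen_badPair (hφ : IsHopping γ ρ φ) (ρ' ε κ : ℝ) (I : Set ℝ) (l : ℕ)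
    (a b : Fin d → ℤ) : IsOpen (badPair ρ ρ' ε φ κ I l a b) := by
  have hunion : badPair ρ ρ' ε φ κ I l a b = ⋃ E ∈ I,
      {v | IsGood ρ ρ' ε φ v κ E l a}ᶜ ∩ {v | IsGood ρ ρ' ε φ v κ E l b}ᶜ := by
    ext v
    simp only [badPair, Set.mem_ofPred_eq, Set.mem_iUnion, Set.mem_inter_iff, Set.mem_compl_iff,
      exists_prop]
  rw [hunion]
  exact isOpen_biUnion fun E _ => (isClosed_setOf_isGood hφ ρ' ε κ E l a).isOpen_compl.inter
    (isClosed_setOf_isGood hφ ρ' ε κ E l b).isOpen_compl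

theorem dependsOn_mem_badPair (ρ ρ' ε : ℝ) (φ : (Fin d → ℤ) → ℂ) (κ : ℝ) (I : Set ℝ) (l : ℕ)
    (a b : Fin d → ℤ) :
    DependsOn (· ∈ badPair ρ ρ' ε φ κ I l a b) ↑(cube l a ∪ cube l b) := by
  intro v v' h
  have ha (E : ℝ) := dependsOn_isGood ρ ρ' ε φ κ E l a fun z hz => h z (by simp_all)
  have hb (E : ℝ) := dependsOn_isGood ρ ρ' ε φ κ E l b fun z hz => h z (by simp_all)
  simp only at ha hb
  simp only [badPair, Set.mem_ofPred_eq, ha, hb]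

end PotentialDependence

section Probability

open MeasureTheory ProbabilityTheory

theorem exists_measurableSet_mem_iff_restrict {ι : Type*} {β : ι → Type*}
    [∀ i, MeasurableSpace (β i)] (c : Π i, β i) {S : Finset ι} {U : Set (Π i, β i)}
    (hU : MeasurableSet U) (hUS : DependsOn (· ∈ U) ↑S) :
    ∃ U' : Set (Π i : S, β i), MeasurableSet U' ∧ ∀ v, v ∈ U ↔ (fun i : S => v i) ∈ U' := by
  classical
  refine ⟨Function.updateFinset c S ⁻¹' U, measurable_updateFinset hU, fun v => ?_⟩
  refine (hUS fun i hi => ?_).to_iff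
  simp [Function.updateFinset, Finset.mem_coe.1 hi]

variable {Ω : Type*} [MeasurableSpace Ω] {P : Measure Ω}

theorem measureReal_inter_of_dependsOn {ι : Type*} {β : ι → Type*} [∀ i, MeasurableSpace (β i)]
    {V : Π i, Ω → β i} (hV : ∀ i, Measurable (V i)) (hind : iIndepFun V P) {S T : Finset ι}
    (hST : Disjoint S T) {U W : Set (Π i, β i)} (hU : MeasurableSet U) (hW : MeasurableSet W)
    (hUS : DependsOn (· ∈ U) ↑S) (hWT : DependsOn (· ∈ W) ↑T) :
    P.real {ω | (fun i => V i ω) ∈ U ∧ (fun i => V i ω) ∈ W} =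
      P.real {ω | (fun i => V i ω) ∈ U} * P.real {ω | (fun i => V i ω) ∈ W} := by
  rcases isEmpty_or_nonempty Ω with _ | ⟨⟨ω₀⟩⟩
  · simp [Measure.eq_zero_of_isEmpty]
  obtain ⟨U', hU', hUU'⟩ := exists_measurableSet_mem_iff_restrict (fun i => V i ω₀) hU hUS
  obtain ⟨W', hW', hWW'⟩ := exists_measurableSet_mem_iff_restrict (fun i => V i ω₀) hW hWT
  simp only [hUU', hWW', measureReal_def, ← ENNReal.toReal_mul]
  exact congrArg ENNReal.toReal
    ((hind.indepFun_finset S T hST hV).measure_inter_preimage_eq_mul U' W' hU' hW')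

/-- The potentials for which four cubes of radius `l` with centres in `B_L(x)` at mutual distance
more than `2 l` are bad at a common energy in `I`. -/
def fourBad (ρ ρ' ε : ℝ) (φ : (Fin d → ℤ) → ℂ) (κ : ℝ) (I : Set ℝ) (l L : ℕ)
    (x : Fin d → ℤ) : Set ((Fin d → ℤ) → ℝ) :=
  {v | ∃ E ∈ I, ∃ s : Fin 4 → Fin d → ℤ,
    (∀ i, s i ∈ cube L x ∧ ¬ IsGood ρ ρ' ε φ v κ E l (s i)) ∧
      Pairwise fun i j => 2 * (l : ℝ) < dist (s i) (s j)}

variable {p q : ℝ} {I : Set ℝ} {V : (Fin d → ℤ) → Ω → ℝ}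

theorem measureReal_badPair_inter_le (hV : ∀ x, Measurable (V x)) (hind : iIndepFun V P)
    (hφ : IsHopping γ ρ φ)
    (hpair : ∀ a b : Fin d → ℤ, 2 * (l : ℝ) < ‖a - b‖ →
      P.real {ω | (fun z => V z ω) ∈ badPair ρ ρ' ε φ κ I l a b} ≤ q)
    {s : Fin 4 → Fin d → ℤ} (hs : Pairwise fun i j => 2 * (l : ℝ) < dist (s i) (s j)) :
    P.real {ω | (fun z => V z ω) ∈ badPair ρ ρ' ε φ κ I l (s 0) (s 1) ∧
      (fun z => V z ω) ∈ badPair ρ ρ' ε φ κ I l (s 2) (s 3)} ≤ q ^ 2 := by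
  have hdisj {i j : Fin 4} (hij : i ≠ j) : Disjoint (cube l (s i)) (cube l (s j)) := by
    have : 2 * (l : ℝ) < dist (s i) (s j) := hs hij
    rw [dist_eq_latticeDist] at this
    exact disjoint_cube (by exact_mod_cast this)
  have hsupp : Disjoint (cube l (s 0) ∪ cube l (s 1)) (cube l (s 2) ∪ cube l (s 3)) := by
    simp only [Finset.disjoint_union_left, Finset.disjoint_union_right]
    exact ⟨⟨hdisj (by decide), hdisj (by decide)⟩, hdisj (by decide), hdisj (by decide)⟩
  have hbad {i j : Fin 4} (hij : i ≠ j) := hpair (s i) (s j) (by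
    rw [← dist_eq_norm]
    exact hs hij)
  rw [measureReal_inter_of_dependsOn hV hind hsupp (isOpen_badPair hφ ρ' ε κ I l _ _).measurableSet
    (isOpen_badPair hφ ρ' ε κ I l _ _).measurableSet (dependsOn_mem_badPair ..)
    (dependsOn_mem_badPair ..), sq]
  exact mul_le_mul (hbad (by decide)) (hbad (by decide)) measureReal_nonneg
    (measureReal_nonneg.trans (hbad (i := 0) (j := 1) (by decide)))

theorem measureReal_fourBad_le [IsProbabilityMeasure P] (hV : ∀ x, Measurable (V x))
    (hind : iIndepFun V P) (hφ : IsHopping γ ρ φ)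
    (hpair : ∀ a b : Fin d → ℤ, 2 * (l : ℝ) < ‖a - b‖ →
      P.real {ω | (fun z => V z ω) ∈ badPair ρ ρ' ε φ κ I l a b} ≤ q) (L : ℕ) (x : Fin d → ℤ) :
    P.real {ω | (fun z => V z ω) ∈ fourBad ρ ρ' ε φ κ I l L x} ≤
      (((2 * L + 1) ^ d : ℕ) : ℝ) ^ 4 * q ^ 2 := by
  classical
  let centres := (Fintype.piFinset fun _ : Fin 4 => cube L x).filter fun s =>
    Pairwise fun i j => 2 * (l : ℝ) < dist (s i) (s j)
  let bothBad (s : Fin 4 → Fin d → ℤ) : Set Ω :=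
    {ω | (fun z => V z ω) ∈ badPair ρ ρ' ε φ κ I l (s 0) (s 1) ∧
      (fun z => V z ω) ∈ badPair ρ ρ' ε φ κ I l (s 2) (s 3)}
  have hcover : {ω | (fun z => V z ω) ∈ fourBad ρ ρ' ε φ κ I l L x} ⊆
      ⋃ s ∈ centres, bothBad s := by
    rintro ω ⟨E, hE, s, hs, hsep⟩
    refine Set.mem_biUnion (Finset.mem_coe.2 (Finset.mem_filter.2
      ⟨Fintype.mem_piFinset.2 fun i => (hs i).1, hsep⟩)) ?_
    exact ⟨⟨E, hE, (hs 0).2, (hs 1).2⟩, ⟨E, hE, (hs 2).2, (hs 3).2⟩⟩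
  have hcard : centres.card ≤ ((2 * L + 1) ^ d) ^ 4 := by
    rw [← card_cube L x, ← Fintype.card_piFinset_const]
    exact Finset.card_filter_le _ _
  calc P.real {ω | (fun z => V z ω) ∈ fourBad ρ ρ' ε φ κ I l L x}
      ≤ P.real (⋃ s ∈ centres, bothBad s) := measureReal_mono hcover (measure_ne_top P _)
    _ ≤ ∑ s ∈ centres, P.real (bothBad s) := measureReal_biUnion_finset_le _ _
    _ ≤ ∑ _ ∈ centres, q ^ 2 := Finset.sum_le_sum fun s hs =>
      measureReal_badPair_inter_le hV hind hφ hpair (Finset.mem_filter.1 hs).2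
    _ ≤ (((2 * L + 1) ^ d : ℕ) : ℝ) ^ 4 * q ^ 2 := by
      rw [Finset.sum_const, nsmul_eq_mul]
      gcongr
      exact_mod_cast hcard

theorem badPair_nextRate_subset (hρ' : 1 < ρ') (hρ : ρ' < ρ) (hκ : 0 ≤ κ) (hγ : 5 * κ ≤ γ)
    (hφ : IsHopping γ ρ φ) (hε : |ε| ≤ ε₁) (hS : IsLargeScale d ρ ρ' α κ ε₁ l L)
    (hmin : 5 / Real.log l ^ (ρ - ρ') ≤ κ) (I : Set ℝ) (x y : Fin d → ℤ) :
    badPair ρ ρ' ε φ (nextRate γ ρ ρ' α κ l) I L x y ⊆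
      {v | ∃ E ∈ I, HasResonance ρ' ε φ v l L E x ∧ HasResonance ρ' ε φ v l L E y} ∪
        (fourBad ρ ρ' ε φ κ I l L x ∪ fourBad ρ ρ' ε φ κ I l L y) := by
  have hcause {v E} (hE : E ∈ I) {z : Fin d → ℤ}
      (hbad : ¬ IsGood ρ ρ' ε φ v (nextRate γ ρ ρ' α κ l) E L z) :
      HasResonance ρ' ε φ v l L E z ∨ v ∈ fourBad ρ ρ' ε φ κ I l L z := by
    by_contra! h
    exact hbad (isGood_nextRate_of_few_bad hρ' hρ hκ hγ hφ hε hS hmin h.1 fun hfour =>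
      h.2 ⟨E, hE, hfour⟩)
  rintro v ⟨E, hE, hx, hy⟩
  rcases hcause hE hx with hresx | hfour
  · rcases hcause hE hy with hresy | hfour
    · exact Or.inl ⟨E, hE, hresx, hresy⟩
    · exact Or.inr (Or.inr hfour)
  · exact Or.inr (Or.inl hfour)

theorem measureReal_badPair_nextRate_le [IsProbabilityMeasure P] (hρ' : 1 < ρ') (hρ : ρ' < ρ)
    (hκ : 0 ≤ κ) (hγ : 5 * κ ≤ γ) (hφ : IsHopping γ ρ φ) (hε : |ε| ≤ ε₁)
    (hS : IsLargeScale d ρ ρ' α κ ε₁ l L) (hmin : 5 / Real.log l ^ (ρ - ρ') ≤ κ)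
    (hV : ∀ x, Measurable (V x)) (hind : iIndepFun V P)
    (hpair : ∀ a b : Fin d → ℤ, 2 * (l : ℝ) < ‖a - b‖ →
      P.real {ω | (fun z => V z ω) ∈ badPair ρ ρ' ε φ κ I l a b} ≤ q)
    (hcount : (((2 * L + 1) ^ d : ℕ) : ℝ) ^ 4 * q ^ 2 ≤ 3 / 8 * p)
    (hres : P.real {ω | ∃ E ∈ I, HasResonance ρ' ε φ (fun z => V z ω) l L E x ∧
      HasResonance ρ' ε φ (fun z => V z ω) l L E y} ≤ 1 / 4 * p) :
    P.real {ω | (fun z => V z ω) ∈ badPair ρ ρ' ε φ (nextRate γ ρ ρ' α κ l) I L x y} ≤ p := by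
  have hfour (z : Fin d → ℤ) := (measureReal_fourBad_le hV hind hφ hpair L z).trans hcount
  refine (measureReal_mono (Set.preimage_mono
    (badPair_nextRate_subset hρ' hρ hκ hγ hφ hε hS hmin I x y)) (measure_ne_top P _)).trans ?_
  refine (measureReal_union_le _ _).trans ((add_le_add hres ((measureReal_union_le _ _).trans
    (add_le_add (hfour x) (hfour y)))).trans ?_)
  linarith

end Probability

section Scales

open Filter Topology

variable {p : ℝ}

theorem exists_pos_forall_of_eventually {q : ℕ → Prop} (h : ∀ᶠ l in atTop, q l) :
    ∃ l₀ : ℝ, 0 < l₀ ∧ ∀ l : ℕ, l₀ ≤ l → q l := by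
  obtain ⟨N, hN⟩ := eventually_atTop.1 h
  refine ⟨N + 1, by positivity, fun l hl => hN l ?_⟩
  exact_mod_cast (le_add_of_nonneg_right zero_le_one).trans hl

theorem tendsto_log_natCast_atTop : Tendsto (fun l : ℕ => Real.log l) atTop atTop :=
  Real.tendsto_log_atTop.comp tendsto_natCast_atTop_atTop

theorem tendsto_natCast_rpow_atTop {s : ℝ} (hs : 0 < s) :
    Tendsto (fun l : ℕ => (l : ℝ) ^ s) atTop atTop :=
  (tendsto_rpow_atTop hs).comp tendsto_natCast_atTop_atTop

theorem tendsto_log_natCast_rpow_atTop {s : ℝ} (hs : 0 < s) :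
    Tendsto (fun l : ℕ => Real.log l ^ s) atTop atTop :=
  (tendsto_rpow_atTop hs).comp tendsto_log_natCast_atTop

theorem tendsto_floor_natCast_rpow_atTop (hα : 0 < α) :
    Tendsto (fun l : ℕ => ⌊(l : ℝ) ^ α⌋₊) atTop atTop :=
  tendsto_nat_floor_atTop.comp (tendsto_natCast_rpow_atTop hα)

theorem rpow_mul_le_two_mul_floor_rpow {s : ℝ} (hs : 0 ≤ s) (hs' : s ≤ 1)
    (hl : 1 ≤ ⌊(l : ℝ) ^ α⌋₊) : (l : ℝ) ^ (s * α) ≤ 2 * (⌊(l : ℝ) ^ α⌋₊ : ℝ) ^ s := by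
  have hfloor : (1 : ℝ) ≤ ⌊(l : ℝ) ^ α⌋₊ := by exact_mod_cast hl
  have hhalf : (l : ℝ) ^ α ≤ 2 * (⌊(l : ℝ) ^ α⌋₊ : ℝ) := by
    linarith [Nat.lt_floor_add_one ((l : ℝ) ^ α)]
  calc (l : ℝ) ^ (s * α) = ((l : ℝ) ^ α) ^ s := by
        rw [← Real.rpow_mul (Nat.cast_nonneg l), mul_comm]
    _ ≤ (2 * (⌊(l : ℝ) ^ α⌋₊ : ℝ)) ^ s := by gcongr
    _ = 2 ^ s * (⌊(l : ℝ) ^ α⌋₊ : ℝ) ^ s := Real.mul_rpow two_pos.le (Nat.cast_nonneg _)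
    _ ≤ 2 * (⌊(l : ℝ) ^ α⌋₊ : ℝ) ^ s := by
      gcongr
      exact Real.rpow_le_self_of_one_le one_le_two hs'

theorem eventually_const_mul_rpow_le {s t : ℝ} (hst : s < t) (c : ℝ) :
    ∀ᶠ l : ℕ in atTop, c * (l : ℝ) ^ s ≤ (l : ℝ) ^ t := by
  filter_upwards [(tendsto_natCast_rpow_atTop (sub_pos.2 hst)).eventually_ge_atTop c,
    eventually_gt_atTop 0] with l hc hl
  calc c * (l : ℝ) ^ s ≤ (l : ℝ) ^ (t - s) * (l : ℝ) ^ s := by gcongr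
    _ = (l : ℝ) ^ t := by rw [← Real.rpow_add (Nat.cast_pos.2 hl), sub_add_cancel]

theorem eventually_log_mul_rpow_le {c A s : ℝ} (hc : 1 ≤ c) (hA : 1 < A) (hs : 0 < s) :
    ∀ᶠ l : ℕ in atTop, Real.log (c * l) ^ s ≤ A * Real.log l ^ s := by
  have hroot : 0 < A ^ s⁻¹ - 1 := sub_pos.2 (Real.one_lt_rpow hA (inv_pos.2 hs))
  filter_upwards [tendsto_log_natCast_atTop.eventually_ge_atTop (Real.log c / (A ^ s⁻¹ - 1)),
    eventually_ge_atTop 1] with l hlog hl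
  rw [div_le_iff₀ hroot] at hlog
  have hl1 : (1 : ℝ) ≤ l := by exact_mod_cast hl
  have hle : Real.log (c * l) ≤ A ^ s⁻¹ * Real.log l := by
    rw [Real.log_mul (by linarith) (by linarith)]
    linarith
  calc Real.log (c * l) ^ s ≤ (A ^ s⁻¹ * Real.log l) ^ s :=
        Real.rpow_le_rpow (Real.log_nonneg (one_le_mul_of_one_le_of_one_le hc hl1)) hle hs.le
    _ = A * Real.log l ^ s := by
      rw [Real.mul_rpow (by positivity) (Real.log_nonneg hl1),
        Real.rpow_inv_rpow (by linarith) hs.ne']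

theorem eventually_mul_pow_lt_exp_log_rpow {s : ℝ} (hs : 1 < s) (K : ℝ) (n : ℕ) :
    ∀ᶠ l : ℕ in atTop, K * (l : ℝ) ^ n < Real.exp (Real.log l ^ s) := by
  filter_upwards [tendsto_natCast_atTop_atTop.eventually_gt_atTop K, eventually_gt_atTop 1,
    (tendsto_log_natCast_rpow_atTop (sub_pos.2 hs)).eventually_ge_atTop (n + 1 : ℝ)] with l hK hl hn
  have hlog : 0 < Real.log l := Real.log_pos (by exact_mod_cast hl)
  calc K * (l : ℝ) ^ n < l * (l : ℝ) ^ n := by gcongr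
    _ = Real.exp ((n + 1 : ℝ) * Real.log l) := by
      rw [← pow_succ', ← Nat.cast_succ, ← Real.log_pow, Real.exp_log (by positivity)]
    _ ≤ Real.exp (Real.log l ^ (s - 1) * Real.log l) := by gcongr
    _ = Real.exp (Real.log l ^ s) := by rw [← Real.rpow_add_one hlog.ne', sub_add_cancel]

theorem eventually_mul_card_sq_lt_exp_log_rpow (d : ℕ) (hρ' : 1 < ρ') (hα : 0 < α) (hα₂ : α ≤ 2)
    {K : ℝ} :
    ∀ᶠ l : ℕ in atTop, K * (((2 * ⌊(l : ℝ) ^ α⌋₊ + 1) ^ d : ℕ) : ℝ) ^ 2 <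
      Real.exp (Real.log l ^ ρ') := by
  filter_upwards [eventually_mul_pow_lt_exp_log_rpow hρ' (|K| * 3 ^ (d * 2)) (2 * (d * 2)),
    (tendsto_floor_natCast_rpow_atTop hα).eventually_ge_atTop 1, eventually_ge_atTop 1]
    with l hexp hfloor hl
  have hsq : (⌊(l : ℝ) ^ α⌋₊ : ℝ) ≤ (l : ℝ) ^ 2 := by
    refine (Nat.floor_le (by positivity)).trans ?_
    rw [← Real.rpow_two]
    exact Real.rpow_le_rpow_of_exponent_le (by exact_mod_cast hl) hα₂
  have hfloor' : (1 : ℝ) ≤ ⌊(l : ℝ) ^ α⌋₊ := by exact_mod_cast hfloor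
  refine lt_of_le_of_lt ?_ hexp
  push_cast
  calc K * ((2 * (⌊(l : ℝ) ^ α⌋₊ : ℝ) + 1) ^ d) ^ 2 ≤ |K| * ((3 * (l : ℝ) ^ 2) ^ d) ^ 2 := by
        gcongr
        · exact le_abs_self K
        · linarith
    _ = |K| * 3 ^ (d * 2) * (l : ℝ) ^ (2 * (d * 2)) := by
      rw [← pow_mul, mul_pow, ← pow_mul, mul_assoc]

theorem eventually_isLargeScale (d : ℕ) (κ ε₁ : ℝ) (hρ' : 1 < ρ') (hα : 5 / 4 < α) (hα₂ : α ≤ 2) :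
    ∀ᶠ l : ℕ in atTop, IsLargeScale d ρ ρ' α κ ε₁ l ⌊(l : ℝ) ^ α⌋₊ := by
  filter_upwards [eventually_ge_atTop 1, tendsto_log_natCast_atTop.eventually_ge_atTop (20 * ρ),
    eventually_const_mul_rpow_le (show (4 / 5 : ℝ) < 1 by norm_num) 2,
    eventually_log_mul_rpow_le (c := 26) (by norm_num) one_lt_two (by linarith : 0 < ρ'),
    (tendsto_log_natCast_rpow_atTop (by linarith : 0 < ρ')).eventually_ge_atTop (κ * ρ ^ ρ),
    eventually_mul_card_sq_lt_exp_log_rpow d hρ' (by linarith) hα₂,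
    eventually_const_mul_rpow_le (show 1 < 4 / 5 * α by linarith) 1000,
    (tendsto_floor_natCast_rpow_atTop (by linarith : 0 < α)).eventually_ge_atTop 1]
    with l hl hlog htwo hlogmul hκ habsorb hlarge hfloor
  have hfloor_pow : (l : ℝ) ^ (4 / 5 * α) ≤ 2 * (⌊(l : ℝ) ^ α⌋₊ : ℝ) ^ (4 / 5 : ℝ) :=
    rpow_mul_le_two_mul_floor_rpow (by norm_num) (by norm_num) hfloor
  rw [Real.rpow_one] at htwo hlarge
  refine ⟨hl, hlog, htwo, by exact_mod_cast hlogmul, hκ, habsorb, by linarith, hfloor_pow, ?_⟩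
  have hl1 : (1 : ℝ) ≤ l := by exact_mod_cast hl
  calc Real.log ⌊(l : ℝ) ^ α⌋₊ ≤ Real.log ((l : ℝ) ^ α) :=
        Real.log_le_log (by exact_mod_cast hfloor) (Nat.floor_le (by positivity))
    _ = α * Real.log l := Real.log_rpow (by linarith) α
    _ ≤ 2 * Real.log l := mul_le_mul_of_nonneg_right hα₂ (Real.log_nonneg hl1)

theorem eventually_count_mul_le (hp : 0 < p) (hα : 0 < α) (hα' : α < 2 * p / (p + 2 * d)) :
    ∀ᶠ l : ℕ in atTop,
      (((2 * ⌊(l : ℝ) ^ α⌋₊ + 1) ^ d : ℕ) : ℝ) ^ 4 * ((l : ℝ) ^ (-2 * p)) ^ 2 ≤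
        3 / 8 * (⌊(l : ℝ) ^ α⌋₊ : ℝ) ^ (-2 * p) := by
  have hexponent : α * (d * 4 + 2 * p) < 4 * p := by
    rw [lt_div_iff₀ (by positivity)] at hα'
    linarith
  filter_upwards [eventually_const_mul_rpow_le hexponent (8 / 3 * 3 ^ (d * 4)),
    (tendsto_floor_natCast_rpow_atTop hα).eventually_ge_atTop 1, eventually_gt_atTop 0]
    with l hbig hfloor hl
  have hl0 : (0 : ℝ) < l := Nat.cast_pos.2 hl
  have hL1 : (1 : ℝ) ≤ ⌊(l : ℝ) ^ α⌋₊ := by exact_mod_cast hfloor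
  have hLle : (⌊(l : ℝ) ^ α⌋₊ : ℝ) ≤ (l : ℝ) ^ α := Nat.floor_le (by positivity)
  push_cast
  set L : ℝ := (⌊(l : ℝ) ^ α⌋₊ : ℝ)
  have hL0 : 0 < L := by linarith
  have hprob : ((l : ℝ) ^ (-2 * p)) ^ 2 = ((l : ℝ) ^ (4 * p))⁻¹ := by
    rw [← Real.rpow_neg hl0.le, ← Real.rpow_mul_natCast hl0.le]
    ring_nf
  have hpower : L ^ (d * 4) * L ^ (2 * p) ≤ (l : ℝ) ^ (α * (d * 4 + 2 * p)) := by
    rw [← Real.rpow_natCast, ← Real.rpow_add hL0, Real.rpow_mul hl0.le]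
    push_cast
    gcongr
  rw [hprob, neg_mul, Real.rpow_neg hL0.le, ← div_eq_mul_inv, ← div_eq_mul_inv,
    div_le_div_iff₀ (by positivity) (by positivity)]
  calc ((2 * L + 1) ^ d) ^ 4 * L ^ (2 * p) ≤ ((3 * L) ^ d) ^ 4 * L ^ (2 * p) := by
        gcongr
        linarith
    _ = 3 ^ (d * 4) * (L ^ (d * 4) * L ^ (2 * p)) := by rw [← pow_mul, mul_pow, mul_assoc]
    _ ≤ 3 ^ (d * 4) * (l : ℝ) ^ (α * (d * 4 + 2 * p)) := by gcongr
    _ ≤ 3 / 8 * (l : ℝ) ^ (4 * p) := by linarith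

end Scales

section Rates

open Filter Topology

theorem tendsto_rate (γ a b : ℝ) (hρ' : 1 < ρ') (hρ : ρ' < ρ) (hα : 5 / 4 < α) :
    Tendsto (fun l : ℕ => γ * (a / Real.log l ^ (ρ - 1)) +
      γ * (a / (l : ℝ) ^ (4 / 5 * α - 1)) + b / Real.log l ^ (ρ - ρ')) atTop (𝓝 0) := by
  have hlog := ((tendsto_log_natCast_rpow_atTop (s := ρ - 1) (by linarith)).const_div_atTop
    a).const_mul γ
  have hpow := ((tendsto_natCast_rpow_atTop (s := 4 / 5 * α - 1) (by linarith)).const_div_atTop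
    a).const_mul γ
  have hloss := (tendsto_log_natCast_rpow_atTop (sub_pos.2 hρ)).const_div_atTop b
  simpa using (hlog.add hpow).add hloss

theorem eventually_minRate_floor_le_nextRate (γ : ℝ) (hρ' : 1 < ρ') (hρ : ρ' < ρ)
    (hα : 5 / 4 < α) (hκ : 0 < κ) :
    ∀ᶠ l : ℕ in atTop, minRate γ ρ ρ' α ⌊(l : ℝ) ^ α⌋₊ ≤ nextRate γ ρ ρ' α κ l := by
  have hmin := ((tendsto_rate γ 11 (31 + 2 ^ ρ) hρ' hρ hα).comp
    (tendsto_floor_natCast_rpow_atTop (by linarith : 0 < α))).eventually_le_const (half_pos hκ)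
  have hnext := (tendsto_rate γ 10 (30 + 2 ^ ρ) hρ' hρ hα).eventually_le_const (half_pos hκ)
  filter_upwards [hmin, hnext] with l hmin hnext
  simp only [Function.comp_apply] at hmin
  rw [minRate, nextRate]
  linarith

theorem sub_minRate_lt_nextRate (hγ : 0 ≤ γ) (hlog : 0 < Real.log l) :
    κ - minRate γ ρ ρ' α l < nextRate γ ρ ρ' α κ l := by
  have hgap : nextRate γ ρ ρ' α κ l - (κ - minRate γ ρ ρ' α l) =
      γ * (1 / Real.log l ^ (ρ - 1)) + γ * (1 / (l : ℝ) ^ (4 / 5 * α - 1)) +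
        1 / Real.log l ^ (ρ - ρ') := by
    rw [minRate, nextRate]
    ring
  rw [← sub_pos, hgap]
  exact add_pos_of_nonneg_of_pos (by positivity) (div_pos one_pos (Real.rpow_pos_of_pos hlog _))

theorem nextRate_lt (hγ : 0 ≤ γ) (hlog : 0 < Real.log l) : nextRate γ ρ ρ' α κ l < κ := by
  rw [nextRate, sub_lt_self_iff]
  exact add_pos_of_nonneg_of_pos (by positivity)
    (div_pos (by positivity) (Real.rpow_pos_of_pos hlog _))

theorem five_div_le_minRate (hγ : 0 ≤ γ) : 5 / Real.log l ^ (ρ - ρ') ≤ minRate γ ρ ρ' α l := by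
  have hloss : 5 / Real.log l ^ (ρ - ρ') ≤ (31 + 2 ^ ρ) / Real.log l ^ (ρ - ρ') := by
    gcongr
    linarith [Real.rpow_pos_of_pos two_pos ρ]
  have hpos : 0 ≤ γ * (11 / Real.log l ^ (ρ - 1)) + γ * (11 / (l : ℝ) ^ (4 / 5 * α - 1)) := by
    positivity
  rw [minRate]
  linarith

theorem eleven_mul_le_minRate (hγ : 0 ≤ γ) (hα : α ≤ 5 / 4) (hl : 1 ≤ l) :
    11 * γ ≤ minRate γ ρ ρ' α l := by
  have hl1 : (1 : ℝ) ≤ l := by exact_mod_cast hl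
  have hpow : (11 : ℝ) ≤ 11 / (l : ℝ) ^ (4 / 5 * α - 1) := by
    rw [le_div_iff₀ (by positivity)]
    linarith [Real.rpow_le_one_of_one_le_of_nonpos hl1 (show 4 / 5 * α - 1 ≤ 0 by linarith)]
  have hrest : 0 ≤ γ * (11 / Real.log l ^ (ρ - 1)) + (31 + 2 ^ ρ) / Real.log l ^ (ρ - ρ') := by
    positivity
  rw [minRate]
  linarith [mul_le_mul_of_nonneg_left hpow hγ]

end Rates

end MSA

theorem theorem3p1_general (d : ℕ) {ρ ρ' p α κ : ℝ} (ε₁ : ℝ) (hρ' : 1 < ρ') (hρ : ρ' < ρ)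
    (hp : 0 < p) (hα : α < 2 * p / (p + 2 * d)) (hκ : 0 < κ) :
    ∃ l₀ : ℝ, 0 < l₀ ∧ ∀ γ : ℝ, ∃ l₁ : ℝ, 0 < l₁ ∧ (5 * κ ≤ γ →
      ∀ (Ω : Type*) [MeasurableSpace Ω] (P : MeasureTheory.Measure Ω)
        [MeasureTheory.IsProbabilityMeasure P]
        (V : (Fin d → ℤ) → Ω → ℝ) (φ : (Fin d → ℤ) → ℂ) (ε : ℝ) (I : Set ℝ) (l L : ℕ),
      (∀ x, Measurable (V x)) → ProbabilityTheory.iIndepFun V P →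
      MSA.IsHopping γ ρ φ → |ε| ≤ ε₁ → L = ⌊(l : ℝ) ^ α⌋₊ → l₀ ≤ l →
      MSA.minRate γ ρ ρ' α l ≤ κ →
      (∀ x y : Fin d → ℤ, 2 * (l : ℝ) < ‖x - y‖ →
        P.real {ω | (fun z => V z ω) ∈ MSA.badPair ρ ρ' ε φ κ I l x y} ≤ (l : ℝ) ^ (-2 * p)) →
      (∀ x y : Fin d → ℤ, 2 * (L : ℝ) < ‖x - y‖ →
        P.real {ω | ∃ E ∈ I, MSA.HasResonance ρ' ε φ (fun z => V z ω) l L E x ∧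
          MSA.HasResonance ρ' ε φ (fun z => V z ω) l L E y} ≤ 1 / 4 * (L : ℝ) ^ (-2 * p)) →
      (∀ x y : Fin d → ℤ, 2 * (L : ℝ) < ‖x - y‖ →
        P.real {ω | (fun z => V z ω) ∈
          MSA.badPair ρ ρ' ε φ (MSA.nextRate γ ρ ρ' α κ l) I L x y} ≤ (L : ℝ) ^ (-2 * p)) ∧
      0 < MSA.nextRate γ ρ ρ' α κ l ∧ MSA.nextRate γ ρ ρ' α κ l < κ ∧
      (l₁ ≤ l → MSA.minRate γ ρ ρ' α L ≤ MSA.nextRate γ ρ ρ' α κ l)) := by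
  have hα₂ : α ≤ 2 := hα.le.trans (div_le_of_le_mul₀ (by positivity) two_pos.le (by linarith))
  obtain ⟨l₀, hl₀, hlarge⟩ := MSA.exists_pos_forall_of_eventually
    (Filter.eventually_imp_distrib_left.2 fun h : 5 / 4 < α =>
      (MSA.eventually_isLargeScale (ρ := ρ) d κ ε₁ hρ' h hα₂).and
        (MSA.eventually_count_mul_le hp (by linarith) hα))
  refine ⟨l₀ + 1, by positivity, fun γ => ?_⟩
  obtain ⟨l₁, hl₁, hrate⟩ := MSA.exists_pos_forall_of_eventually
    (Filter.eventually_imp_distrib_left.2 fun h : 5 / 4 < α =>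
      MSA.eventually_minRate_floor_le_nextRate γ hρ' hρ h hκ)
  refine ⟨l₁, hl₁, ?_⟩
  rintro hγ Ω _ P _ V φ ε I l L hV hind hφ hε rfl hl hmin hpair hres
  have hγ₀ : 0 ≤ γ := by linarith
  have hl1 : 1 ≤ l := Nat.cast_pos.1 (hl₀.trans_le (by linarith))
  have hα₁ : 5 / 4 < α := by
    by_contra! h
    linarith [MSA.eleven_mul_le_minRate (ρ := ρ) (ρ' := ρ') hγ₀ h hl1]
  obtain ⟨hS, hcount⟩ := hlarge l (by linarith) hα₁
  have hlog : 0 < Real.log l := hS.log_pos (by linarith)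
  have hgap := MSA.sub_minRate_lt_nextRate (ρ := ρ) (ρ' := ρ') (α := α) (κ := κ) hγ₀ hlog
  refine ⟨fun x y hxy => ?_, by linarith, MSA.nextRate_lt hγ₀ hlog, fun h => hrate l h hα₁⟩
  exact MSA.measureReal_badPair_nextRate_le hρ' hρ hκ.le hγ hφ hε hS
    ((MSA.five_div_le_minRate hγ₀).trans hmin) hV hind hpair hcount (hres x y hxy)

theorem theorem3p1 (d : ℕ) (hd : 1 ≤ d) (ρ ρ' p α κ ε₁ : ℝ)
    (hρ' : 1 < ρ') (hρ : ρ' < ρ) (hp : 5 * (d : ℝ) < p)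
    (hα : 4 / 5 < α) (hα' : α < 2 * p / (p + 2 * d)) (hκ : 0 < κ) (hε₁ : 0 < ε₁) :
    ∃ l₀ : ℝ, 0 < l₀ ∧ ∀ γ : ℝ, 0 < γ → ∃ l₁ : ℝ, 0 < l₁ ∧
      ∀ (κ₀ : ℝ), κ ≤ κ₀ → κ₀ ≤ γ / 5 →
      ∀ (Ω : Type*) [MeasurableSpace Ω] (P : MeasureTheory.Measure Ω)
        [MeasureTheory.IsProbabilityMeasure P]
        (V : (Fin d → ℤ) → Ω → ℝ) (φ : (Fin d → ℤ) → ℂ) (ε : ℝ) (I : Set ℝ) (l L : ℕ),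
      (∀ x, Measurable (V x)) → ProbabilityTheory.iIndepFun V P →
      (∀ x, ProbabilityTheory.IdentDistrib (V x) (V 0) P P) →
      MSA.IsHopping γ ρ φ → 0 < ε → ε ≤ ε₁ →
      L = ⌊(l : ℝ) ^ α⌋₊ → l₀ ≤ l →
      MSA.minRate γ ρ ρ' α l ≤ κ →
      (∀ x y : Fin d → ℤ, 2 * (l : ℝ) < ‖x - y‖ →
        P.real {ω | ∃ E ∈ I, ¬ MSA.IsGood ρ ρ' ε φ (fun z => V z ω) κ E l x ∧
          ¬ MSA.IsGood ρ ρ' ε φ (fun z => V z ω) κ E l y} ≤ (l : ℝ) ^ (-2 * p)) →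
      (∀ x y : Fin d → ℤ, 2 * (L : ℝ) < ‖x - y‖ →
        P.real {ω | ∃ E ∈ I, MSA.HasResonance ρ' ε φ (fun z => V z ω) l L E x ∧
          MSA.HasResonance ρ' ε φ (fun z => V z ω) l L E y} ≤ 1 / 4 * (L : ℝ) ^ (-2 * p)) →
      (∀ x y : Fin d → ℤ, 2 * (L : ℝ) < ‖x - y‖ →
        P.real {ω | ∃ E ∈ I,
          ¬ MSA.IsGood ρ ρ' ε φ (fun z => V z ω) (MSA.nextRate γ ρ ρ' α κ l) E L x ∧
          ¬ MSA.IsGood ρ ρ' ε φ (fun z => V z ω) (MSA.nextRate γ ρ ρ' α κ l) E L y} ≤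
            (L : ℝ) ^ (-2 * p)) ∧
      0 < MSA.nextRate γ ρ ρ' α κ l ∧ MSA.nextRate γ ρ ρ' α κ l < κ ∧ κ ≤ κ₀ ∧
      (l₁ ≤ l → MSA.minRate γ ρ ρ' α L ≤ MSA.nextRate γ ρ ρ' α κ l) := by
  obtain ⟨l₀, hl₀, h⟩ := theorem3p1_general d ε₁ hρ' hρ
    ((by positivity : 0 ≤ 5 * (d : ℝ)).trans_lt hp) hα' hκ
  refine ⟨l₀, hl₀, fun γ _ => (h γ).imp fun l₁ h => ⟨h.1, ?_⟩⟩
  intro κ₀ hκ₀ hκγ Ω _ P _ V φ ε I l L hV hind _ hφ hε hε' hL hl hmin hpair hres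
  obtain ⟨hbad, hpos, hlt, hnext⟩ := h.2 (by linarith) Ω P V φ ε I l L hV hind hφ
    ((abs_of_pos hε).trans_le hε') hL hl hmin hpair hres
  exact ⟨hbad, hpos, hlt, hκ₀, hnext⟩
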